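/- Let $\mathbb K$ be a commutative ring. For a group $G$, let $N G$ be the normalized bar complex of $G$ over $\mathbb K$, i.e. the normalized chain complex of the simplicial module $\mathbb K[\mathrm{nerve}(G)]$ (chains modulo degenerate chains): $N_nG$ is spanned by the classes $\langle g_1,\dots,g_n\rangle$ of tuples of elements of $G$, and $\langle g_1,\dots,g_n\rangle=0$ if some $g_i=1$. Its homology is $H_*(G)$. For a subset $X\subseteq G$ with $1\in X$ (a pointed subset), let $N_nX\subseteq N_nG$ be the span of the $\langle x_1,\dots,x_n\rangle$ with all $x_i\in X$, let $\Omega(G,X)\subseteq NG$ be the largest subcomplex contained in $(N_nX)_n$, that is, $\Omega_n(G,X)=N_nX\cap\partial^{-1}(N_{n-1}X)$, and put $H_*(G,X)=H_*(\Omega(G,X))$. A homomorphism $f:G\to G'$ with $f(X)\subseteq X'$ induces $H_*(f):H_*(G,X)\to H_*(G',X')$. The Eilenberg–Zilber (shuffle) map is $$\varepsilon: N_pG\otimes N_qG'\to N_{p+q}(G\times G'),\qquad \varepsilon(a\otimes a')=\sum_{(\mu,\nu)}\mathrm{sgn}(\mu,\nu)\, s_\mu a\otimes s_\nu a',$$ the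 sum being over all partitions of $\{0,\dots,p+q-1\}$ into $\mu$ with $q$ elements and $\nu$ with $p$ elements, where $\mathrm{sgn}(\mu,\nu)$ is the sign of the permutation listing $\nu$ in increasing order and then $\mu$ in increasing order. Let $G$ be an abelian group and $X\subseteq G$ a pointed subset, and put $X\vee X=(X\times 1)\cup(1\times X)\subseteq G\times G$. Then: 1. The map $\varepsilon$ and the multiplication $G\times G\to G$ induce a well-defined product $$H_p(G,X)\otimes H_q(G,X)\to H_{p+q}(G\times G,X\vee X)\to H_{p+q}(G,X),$$ the Pontryagin product. With it, $H_*(G,X)=\bigoplus_n H_n(G,X)$ is a graded associative $\mathbb K$-algebra, with unit the class in $H_0(G,X)$ of the vertex $\langle\,\rangle$, and it is graded-commutative: $ab=(-1)^{pq}ba$ for $a\in H_p(G,X)$, $b\in H_q(G,X)$. 2. This structure is natural: if $G'$ is an abelian group, $X'\subseteq G'$ is a pointed subset and $f:G\to G'$ is a homomorphism with $f(X)\subseteq X'$, then $H_*(f):H_*(G,X)\to H_*(G',X')$ is a homomorphism of unital algebras. 3. If $X=G$, the map $H_*(G,X)\to H_*(G)$ induced by the inclusion $\Omega(G,X)\subseteq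 NG$ is an isomorphism of unital algebras, where $H_*(G)$ carries the classical Pontryagin product, the (well-defined) composite $H_p(G)\otimes H_q(G)\to H_{p+q}(G\times G)\to H_{p+q}(G)$ induced by $\varepsilon$ and the multiplication. -/

import Mathlib

universe u v w

noncomputable section

namespace SubsetHomology

/-! ### The normalized bar complex `N G` of a group -/

section Nerve

variable (K : Type w) [CommRing K] (G : Type u) [Group G]

variable {G} in
/-- The face maps `d₀, …, dₙ₊₁` of the nerve of `G`. An `n`-simplex of the nerve of `G` (a category
with one object) is a tuple `(g₁, …, gₙ)`, here indexed from `0`; `d₀` forgets the first entry, the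
last face forgets the last entry, and an inner face `dₖ` replaces `gₖ, gₖ₊₁` by `gₖ₊₁ gₖ`. -/
def face {n : ℕ} (k : Fin (n + 2)) (g : Fin (n + 1) → G) (j : Fin n) : G :=
  if (j : ℕ) + 1 < k then g j.castSucc
  else if (j : ℕ) + 1 = k then g j.succ * g j.castSucc
  else g j.succ

/-- `K[nerve G]` in degree `n`. -/
abbrev Chain (n : ℕ) : Type (max u w) := (Fin n → G) →₀ K

/-- The differential `∑ (-1)ᵏ dₖ` of `K[nerve G]`. -/
def boundary (n : ℕ) : Chain K G (n + 1) →ₗ[K] Chain K G n :=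
  Finsupp.linearCombination K
    (fun g => ∑ k : Fin (n + 2), Finsupp.single (face k g) ((-1 : K) ^ (k : ℕ)))

/-- The degenerate chains. The degeneracy `sᵢ` inserts the identity in front of the `i`-th entry
(counted from `0`), so the degenerate simplices are the tuples with an entry equal to `1`. -/
def degenerate (n : ℕ) : Submodule K (Chain K G n) :=
  Submodule.span K ((fun g => Finsupp.single g (1 : K)) '' {g | ∃ i, g i = 1})

/-- The normalized complex `N G` in degree `n`: chains modulo degenerate chains. -/
def NChain (n : ℕ) : Type (max u w) := Chain K G n ⧸ degenerate K G n

instance (n : ℕ) : AddCommGroup (NChain K G n) :=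
  inferInstanceAs (AddCommGroup (Chain K G n ⧸ degenerate K G n))

instance (n : ℕ) : Module K (NChain K G n) :=
  inferInstanceAs (Module K (Chain K G n ⧸ degenerate K G n))

/-- The projection from `K[nerve G]` to `N G`. -/
def proj (n : ℕ) : Chain K G n →ₗ[K] NChain K G n := (degenerate K G n).mkQ

theorem proj_surjective (n : ℕ) : Function.Surjective (proj K G n) :=
  Submodule.mkQ_surjective _

theorem proj_eq_zero_iff {n : ℕ} {x : Chain K G n} :
    proj K G n x = 0 ↔ x ∈ degenerate K G n :=
  Submodule.Quotient.mk_eq_zero _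

variable {K G} in
/-- The map out of `N G` induced by a linear map that vanishes on degenerate chains. -/
def NChain.lift {n : ℕ} {M : Type*} [AddCommGroup M] [Module K M] (φ : Chain K G n →ₗ[K] M)
    (h : ∀ x ∈ degenerate K G n, φ x = 0) : NChain K G n →ₗ[K] M :=
  (degenerate K G n).liftQ φ h

variable {K G} in
@[simp]
theorem NChain.lift_proj {n : ℕ} {M : Type*} [AddCommGroup M] [Module K M]
    (φ : Chain K G n →ₗ[K] M) (h : ∀ x ∈ degenerate K G n, φ x = 0) (x : Chain K G n) :
    NChain.lift φ h (proj K G n x) = φ x :=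
  Submodule.liftQ_apply _ _ _

variable {G} in
/-- The class `⟨g₁, …, gₙ⟩` of a simplex in the normalized complex. -/
def simplex {n : ℕ} (g : Fin n → G) : NChain K G n :=
  proj K G n (Finsupp.single g 1)

variable {K G} in
theorem single_mem_degenerate {n : ℕ} {g : Fin n → G} {i : Fin n} (h : g i = 1) (c : K) :
    Finsupp.single g c ∈ degenerate K G n := by
  have : Finsupp.single g c = c • Finsupp.single g (1 : K) := by simp
  rw [this]
  exact Submodule.smul_mem _ _ (Submodule.subset_span ⟨g, ⟨i, h⟩, rfl⟩)

theorem face_castSucc_eq_face_succ {n : ℕ} {g : Fin (n + 1) → G} {i : Fin (n + 1)}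
    (h : g i = 1) : face i.castSucc g = face i.succ g := by
  funext j
  simp only [face, Fin.val_castSucc, Fin.val_succ]
  rcases lt_trichotomy ((j : ℕ) + 1) i with hj | hj | hj
  · rw [if_pos hj, if_pos (by omega)]
  · have hi : j.succ = i := Fin.ext (by simpa using hj)
    rw [if_neg (by omega), if_pos hj, if_pos (by omega), hi, h, one_mul]
  · rw [if_neg (by omega), if_neg (by omega), if_neg (by omega)]
    by_cases hji : (j : ℕ) = i
    · have hi : j.castSucc = i := Fin.ext (by simpa using hji)
      rw [if_pos (by omega), hi, h, mul_one]
    · rw [if_neg (by omega)]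

theorem exists_face_eq_one {n : ℕ} {g : Fin (n + 1) → G} {i : Fin (n + 1)} (h : g i = 1)
    {k : Fin (n + 2)} (h₁ : k ≠ i.castSucc) (h₂ : k ≠ i.succ) : ∃ j, face k g j = 1 := by
  have h₁' : (k : ℕ) ≠ i := fun e => h₁ (Fin.ext (by simpa using e))
  have h₂' : (k : ℕ) ≠ i + 1 := fun e => h₂ (Fin.ext (by simpa using e))
  have hi := i.isLt
  have hk := k.isLt
  rcases lt_or_gt_of_ne h₁' with hlt | hgt
  · refine ⟨⟨(i : ℕ) - 1, by omega⟩, ?_⟩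
    have e : (⟨(i : ℕ) - 1, by omega⟩ : Fin n).succ = i := Fin.ext (by simp; omega)
    simp only [face]
    rw [if_neg (by omega), if_neg (by omega), e, h]
  · refine ⟨⟨(i : ℕ), by omega⟩, ?_⟩
    have e : (⟨(i : ℕ), by omega⟩ : Fin n).castSucc = i := rfl
    simp only [face]
    rw [if_pos (by omega), e, h]

theorem degenerate_le_comap_boundary (n : ℕ) :
    degenerate K G (n + 1) ≤ (degenerate K G n).comap (boundary K G n) := by
  refine Submodule.span_le.2 ?_
  rintro _ ⟨g, ⟨i, hi⟩, rfl⟩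
  simp only [Submodule.comap_coe, Set.mem_preimage, SetLike.mem_coe, boundary,
    Finsupp.linearCombination_single, one_smul]
  rw [← proj_eq_zero_iff, map_sum,
    Fintype.sum_eq_add i.castSucc i.succ (by simp [Fin.ext_iff]), ← map_add,
    face_castSucc_eq_face_succ G hi, ← Finsupp.single_add]
  · simp [pow_succ]
  · rintro k ⟨h₁, h₂⟩
    obtain ⟨j, hj⟩ := exists_face_eq_one G hi h₁ h₂
    exact (proj_eq_zero_iff K G).2 (single_mem_degenerate hj _)

/-- The differential of `N G`. -/
def d (n : ℕ) : NChain K G (n + 1) →ₗ[K] NChain K G n :=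
  NChain.lift ((proj K G n).comp (boundary K G n))
    (fun _ hx => (proj_eq_zero_iff K G).2 (degenerate_le_comap_boundary K G n hx))

end Nerve

/-! ### Functoriality of `N G` -/

section Functoriality

variable (K : Type w) [CommRing K] {G : Type u} [Group G] {G' : Type v} [Group G']

/-- The map `K[nerve G] → K[nerve G']` induced by a homomorphism. -/
def chainMap (f : G →* G') (n : ℕ) : Chain K G n →ₗ[K] Chain K G' n :=
  Finsupp.lmapDomain K K (fun g i => f (g i))

theorem degenerate_le_comap_chainMap (f : G →* G') (n : ℕ) :
    degenerate K G n ≤ (degenerate K G' n).comap (chainMap K f n) := by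
  refine Submodule.span_le.2 ?_
  rintro _ ⟨g, ⟨i, hi⟩, rfl⟩
  simp only [Submodule.comap_coe, Set.mem_preimage, SetLike.mem_coe, chainMap,
    Finsupp.lmapDomain_apply, Finsupp.mapDomain_single]
  exact single_mem_degenerate (i := i) (by simp [hi]) _

/-- The map `N G → N G'` induced by a homomorphism. -/
def nMap (f : G →* G') (n : ℕ) : NChain K G n →ₗ[K] NChain K G' n :=
  NChain.lift ((proj K G' n).comp (chainMap K f n))
    (fun _ hx => (proj_eq_zero_iff K G').2 (degenerate_le_comap_chainMap K f n hx))

theorem nMap_simplex (f : G →* G') {n : ℕ} (g : Fin n → G) :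
    nMap K f n (simplex K g) = simplex K (fun i => f (g i)) := by
  simp [nMap, simplex, chainMap]

theorem d_nMap (f : G →* G') (n : ℕ) (x : NChain K G (n + 1)) :
    d K G' n (nMap K f (n + 1) x) = nMap K f n (d K G n x) := by
  obtain ⟨x, rfl⟩ := proj_surjective K G _ x
  have key : (boundary K G' n).comp (chainMap K f (n + 1))
      = (chainMap K f n).comp (boundary K G n) := by
    refine Finsupp.lhom_ext' fun g => LinearMap.ext_ring ?_
    have hf : ∀ k : Fin (n + 2), face k (fun i => f (g i)) = fun i => f (face k g i) := by
      intro k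
      funext j
      simp only [face]
      split_ifs <;> simp
    simp [boundary, chainMap, Finsupp.mapDomain_single, hf]
  have := LinearMap.congr_fun key x
  simp only [LinearMap.comp_apply] at this
  simp [nMap, d, this]

end Functoriality

/-! ### Graded submodules of `N G` and their homology -/

section Homology

variable {K : Type w} [CommRing K] {G : Type u} [Group G] {G' : Type v} [Group G']

variable (K G) in
/-- Graded submodules of `N G`, not necessarily subcomplexes. -/
abbrev GradedSub : Type (max u w) := ∀ n : ℕ, Submodule K (NChain K G n)

/-- The largest subcomplex `ω(N G, D)` of `N G` inside `D`, with components
`Dₙ ∩ ∂⁻¹(Dₙ₋₁)`. -/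
def omega (D : GradedSub K G) : GradedSub K G
  | 0 => D 0
  | n + 1 => D (n + 1) ⊓ (D n).comap (d K G n)

/-- The `n`-cycles of a subcomplex `W` of `N G`. -/
def cycles (W : GradedSub K G) : GradedSub K G
  | 0 => W 0
  | n + 1 => W (n + 1) ⊓ LinearMap.ker (d K G n)

/-- The `n`-boundaries of a subcomplex `W` of `N G`. -/
def boundaries (W : GradedSub K G) : GradedSub K G :=
  fun n => (W (n + 1)).map (d K G n)

/-- The homology `Hₙ(W)` of a subcomplex `W` of `N G`: cycles modulo boundaries. -/
def Homology (W : GradedSub K G) (n : ℕ) : Type (max u w) :=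
  cycles W n ⧸ (boundaries W n).submoduleOf (cycles W n)

instance (W : GradedSub K G) (n : ℕ) : AddCommGroup (Homology W n) :=
  inferInstanceAs (AddCommGroup (cycles W n ⧸ (boundaries W n).submoduleOf (cycles W n)))

instance (W : GradedSub K G) (n : ℕ) : Module K (Homology W n) :=
  inferInstanceAs (Module K (cycles W n ⧸ (boundaries W n).submoduleOf (cycles W n)))

/-- The homology class of a cycle. -/
def homologyClass (W : GradedSub K G) {n : ℕ} (x : NChain K G n) (hx : x ∈ cycles W n) :
    Homology W n :=
  ((boundaries W n).submoduleOf (cycles W n)).mkQ ⟨x, hx⟩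

/-- The total homology `H_*(W) = ⨁ₙ Hₙ(W)`. -/
abbrev TotalHomology (W : GradedSub K G) : Type (max u w) :=
  DirectSum ℕ (fun n => Homology W n)

/-- The inclusion of `Hₙ(W)` in `H_*(W)`. -/
def incl (W : GradedSub K G) (n : ℕ) : Homology W n →ₗ[K] TotalHomology W :=
  DirectSum.lof K ℕ (fun n => Homology W n) n

theorem nMap_mem_cycles {W : GradedSub K G} {W' : GradedSub K G'} (f : G →* G')
    (hf : ∀ n, W n ≤ (W' n).comap (nMap K f n)) (n : ℕ) :
    ∀ x ∈ cycles W n, nMap K f n x ∈ cycles W' n := by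
  intro x hx
  cases n with
  | zero => exact hf 0 hx
  | succ n =>
    refine ⟨hf _ hx.1, ?_⟩
    have h : d K G n x = 0 := hx.2
    simp [d_nMap, h]

/-- The map `Hₙ(W) → Hₙ(W')` induced by a homomorphism `f : G → G'` that takes the subcomplex
`W` to the subcomplex `W'`. -/
def homologyMap {W : GradedSub K G} {W' : GradedSub K G'} (f : G →* G')
    (hf : ∀ n, W n ≤ (W' n).comap (nMap K f n)) (n : ℕ) :
    Homology W n →ₗ[K] Homology W' n :=
  Submodule.mapQ _ _ ((nMap K f n).restrict (nMap_mem_cycles f hf n)) (by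
    rintro ⟨x, hx⟩ hb
    obtain ⟨y, hy, hyx⟩ := hb
    exact ⟨nMap K f (n + 1) y, hf _ hy, by
      rw [d_nMap, hyx]
      rfl⟩)

/-- The map `H_*(W) → H_*(W')` induced by a homomorphism. -/
def totalHomologyMap {W : GradedSub K G} {W' : GradedSub K G'} (f : G →* G')
    (hf : ∀ n, W n ≤ (W' n).comap (nMap K f n)) :
    TotalHomology W →ₗ[K] TotalHomology W' :=
  DirectSum.lmap (homologyMap f hf)

end Homology

/-! ### Homology of pointed subsets of groups -/

section Subsets

variable (K : Type w) [CommRing K] {G : Type u} [Group G] {G' : Type v} [Group G']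

/-- The image of `K[nerve X]` in `N G`: the span of the `⟨x₁, …, xₙ⟩` with entries in `X`. -/
def pathSub (X : Set G) : GradedSub K G :=
  fun n => Submodule.span K (simplex K '' {g : Fin n → G | ∀ i, g i ∈ X})

/-- The complex `Ω(G, X)`, as a subcomplex of `N G`. Its homology is `H_*(G, X)`. -/
def Omega (X : Set G) : GradedSub K G := omega (pathSub K X)

/-- `N G` as a subcomplex of itself. Its homology is the ordinary group homology `H_*(G)`. -/
def full (G : Type u) [Group G] : GradedSub K G := fun _ => ⊤

theorem pathSub_le_comap {X : Set G} {X' : Set G'} (f : G →* G') (hf : Set.MapsTo f X X')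
    (n : ℕ) : pathSub K X n ≤ (pathSub K X' n).comap (nMap K f n) := by
  refine Submodule.span_le.2 ?_
  rintro _ ⟨g, hg, rfl⟩
  simp only [Submodule.comap_coe, Set.mem_preimage, SetLike.mem_coe, nMap_simplex]
  exact Submodule.subset_span ⟨_, fun i => hf (hg i), rfl⟩

theorem Omega_le_comap {X : Set G} {X' : Set G'} (f : G →* G') (hf : Set.MapsTo f X X')
    (n : ℕ) : Omega K X n ≤ (Omega K X' n).comap (nMap K f n) := by
  cases n with
  | zero => exact pathSub_le_comap K f hf 0
  | succ n =>
    rintro x ⟨hx, hdx⟩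
    refine ⟨pathSub_le_comap K f hf _ hx, ?_⟩
    simp only [Submodule.comap_coe, Set.mem_preimage, SetLike.mem_coe, d_nMap]
    exact pathSub_le_comap K f hf _ hdx

/-- The map `H_*(G, X) → H_*(G', X')` induced by a morphism of pointed subsets. -/
def subsetMap {X : Set G} {X' : Set G'} (f : G →* G') (hf : Set.MapsTo f X X') :
    TotalHomology (Omega K X) →ₗ[K] TotalHomology (Omega K X') :=
  totalHomologyMap f (Omega_le_comap K f hf)

/-- The map `H_*(G, X) → H_*(G)` induced by the inclusion of `Ω(G, X)` in `N G`. -/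
def toGroupHomology (X : Set G) : TotalHomology (Omega K X) →ₗ[K] TotalHomology (full K G) :=
  totalHomologyMap (MonoidHom.id G) (fun _ _ _ => Submodule.mem_top)

/-- The class in `H₀(G, X)` of the only vertex of the nerve. -/
def subsetOne (X : Set G) : TotalHomology (Omega K X) :=
  incl (Omega K X) 0 (homologyClass (Omega K X) (simplex K (fun i : Fin 0 => i.elim0))
    (Submodule.subset_span ⟨_, fun i => i.elim0, rfl⟩))

/-- The class in `H₀(G)` of the only vertex of the nerve. -/
def groupOne (G : Type u) [Group G] : TotalHomology (full K G) :=
  incl (full K G) 0 (homologyClass (full K G) (simplex K (fun i : Fin 0 => i.elim0))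
    Submodule.mem_top)

/-- `X ∨ X' = (X × 1) ∪ (1 × X')`. -/
def wedge (X : Set G) (X' : Set G') : Set (G × G') := X ×ˢ {1} ∪ {1} ×ˢ X'

end Subsets

/-! ### The Eilenberg–Zilber map -/

section EilenbergZilber

/-- A shuffle of `p` and `q` letters: a partition of the `p + q` positions into the positions
`e (inl 0) < … < e (inl (p - 1))` and `e (inr 0) < … < e (inr (q - 1))`. -/
def Shuffle (p q : ℕ) : Type :=
  {e : Fin p ⊕ Fin q ≃ Fin (p + q) //
    StrictMono (fun i => e (Sum.inl i)) ∧ StrictMono (fun j => e (Sum.inr j))}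

instance (p q : ℕ) : Finite (Shuffle p q) := Subtype.finite

instance (p q : ℕ) : Fintype (Shuffle p q) := Fintype.ofFinite _

/-- The sign of a shuffle: the sign of the permutation that lists the positions of the first
kind and then those of the second kind. -/
def Shuffle.sgn {p q : ℕ} (e : Shuffle p q) : ℤˣ :=
  Equiv.Perm.sign (finSumFinEquiv.symm.trans e.1)

variable (K : Type w) [CommRing K] {G : Type u} [Group G] {G' : Type v} [Group G']

/-- The iterated degeneracy that puts the entries of a `p`-simplex, in order, at the positions of
the first kind, and identities at the positions of the second kind. -/
def Shuffle.degenLeft {p q : ℕ} (e : Shuffle p q) (g : Fin p → G) : Fin (p + q) → G :=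
  fun k => Sum.elim g (fun _ => 1) (e.1.symm k)

/-- The iterated degeneracy that puts the entries of a `q`-simplex, in order, at the positions of
the second kind, and identities at the positions of the first kind. -/
def Shuffle.degenRight {p q : ℕ} (e : Shuffle p q) (h : Fin q → G') : Fin (p + q) → G' :=
  fun k => Sum.elim (fun _ => 1) h (e.1.symm k)

/-- The Eilenberg–Zilber map on unnormalized chains, `a ⊗ b ↦ ∑ sgn(μ, ν) s_μ a ⊗ s_ν b`, where
`K[nerve G]ₙ ⊗ K[nerve G']ₙ` is identified with `K[nerve (G × G')]ₙ`. -/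
def ezChain (p q : ℕ) : Chain K G p →ₗ[K] Chain K G' q →ₗ[K] Chain K (G × G') (p + q) :=
  Finsupp.linearCombination K (fun g => Finsupp.linearCombination K (fun h =>
    ∑ e : Shuffle p q,
      Finsupp.single (fun k => (e.degenLeft g k, e.degenRight h k)) (((e.sgn : ℤˣ) : ℤ) : K)))

theorem ezChain_left (p q : ℕ) {a : Chain K G p} (ha : a ∈ degenerate K G p)
    (b : Chain K G' q) : ezChain K p q a b ∈ degenerate K (G × G') (p + q) := by
  suffices h : degenerate K G p ≤
      (degenerate K (G × G') (p + q)).comap ((ezChain K p q).flip b) from h ha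
  refine Submodule.span_le.2 ?_
  rintro _ ⟨g, ⟨i, hi⟩, rfl⟩
  simp only [Submodule.comap_coe, Set.mem_preimage, SetLike.mem_coe, LinearMap.flip_apply]
  induction b using Finsupp.induction_linear with
  | zero => simp
  | add b c hb hc => rw [map_add]; exact Submodule.add_mem _ hb hc
  | single h c =>
    simp only [ezChain, Finsupp.linearCombination_single, one_smul]
    refine Submodule.smul_mem _ _ (Submodule.sum_mem _ fun e _ => ?_)
    exact single_mem_degenerate (i := e.1 (Sum.inl i))
      (by simp [Shuffle.degenLeft, Shuffle.degenRight, hi]) _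

theorem ezChain_right (p q : ℕ) (a : Chain K G p) {b : Chain K G' q}
    (hb : b ∈ degenerate K G' q) : ezChain K p q a b ∈ degenerate K (G × G') (p + q) := by
  suffices h : degenerate K G' q ≤
      (degenerate K (G × G') (p + q)).comap (ezChain K p q a) from h hb
  refine Submodule.span_le.2 ?_
  rintro _ ⟨h, ⟨i, hi⟩, rfl⟩
  simp only [Submodule.comap_coe, Set.mem_preimage, SetLike.mem_coe]
  induction a using Finsupp.induction_linear with
  | zero => simp
  | add b c hb hc => rw [map_add]; exact Submodule.add_mem _ hb hc
  | single g c =>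
    simp only [ezChain, Finsupp.linearCombination_single, one_smul, LinearMap.smul_apply]
    refine Submodule.smul_mem _ _ (Submodule.sum_mem _ fun e _ => ?_)
    exact single_mem_degenerate (i := e.1 (Sum.inr i))
      (by simp [Shuffle.degenLeft, Shuffle.degenRight, hi]) _

/-- The Eilenberg–Zilber map `ε : N G ⊗ N G' → N (G × G')`, as a family of bilinear maps. -/
def ez (p q : ℕ) : NChain K G p →ₗ[K] NChain K G' q →ₗ[K] NChain K (G × G') (p + q) :=
  (NChain.lift
    (NChain.lift ((ezChain K p q).compr₂ (proj K (G × G') (p + q)))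
      (fun _ ha => LinearMap.ext fun b =>
        (proj_eq_zero_iff K (G × G')).2 (ezChain_left K p q ha b))).flip
    (fun _ hb => LinearMap.ext fun a => by
      obtain ⟨a, rfl⟩ := proj_surjective K G _ a
      simpa using (proj_eq_zero_iff K (G × G')).2 (ezChain_right K p q a hb))).flip

theorem ez_proj_proj (p q : ℕ) (a : Chain K G p) (b : Chain K G' q) :
    ez K p q (proj K G p a) (proj K G' q b) = proj K (G × G') (p + q) (ezChain K p q a b) := by
  simp [ez]

end EilenbergZilber

/-! ### Products on homology -/

section Products

variable {K : Type w} [CommRing K] {G : Type u}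

/-- The bilinear maps `c p q : H_p(W) × H_q(W') → H_{p+q}(W'')` are induced by the Eilenberg–Zilber
map: `ε` takes pairs of cycles to cycles, and `c [x] [y] = [ε(x ⊗ y)]`. -/
def InducedByEZ {G' : Type v} [Group G] [Group G'] (W : GradedSub K G) (W' : GradedSub K G')
    (W'' : GradedSub K (G × G'))
    (c : ∀ p q : ℕ, Homology W p →ₗ[K] Homology W' q →ₗ[K] Homology W'' (p + q)) : Prop :=
  ∀ (p q : ℕ) (x : NChain K G p) (hx : x ∈ cycles W p) (y : NChain K G' q)
    (hy : y ∈ cycles W' q), ∃ h : ez K p q x y ∈ cycles W'' (p + q),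
      c p q (homologyClass W x hx) (homologyClass W' y hy) = homologyClass W'' (ez K p q x y) h

theorem mapsTo_mul_wedge [CommGroup G] (X : Set G) :
    Set.MapsTo (mulMonoidHom : G × G →* G) (wedge X X) X := by
  rintro ⟨a, b⟩ (⟨ha, hb⟩ | ⟨ha, hb⟩)
  · have hb' : b = 1 := hb
    simpa [hb'] using ha
  · have ha' : a = 1 := ha
    simpa [ha'] using hb

/-- `m` is the Pontryagin product on `H_*(G, X)`: on homogeneous elements it is the composite
`H_p(G, X) ⊗ H_q(G, X) → H_{p+q}(G × G, X ∨ X) → H_{p+q}(G, X)` of the map induced by the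
Eilenberg–Zilber map and the map induced by the multiplication of `G`. -/
def IsPontryaginProduct [CommGroup G] (X : Set G)
    (m : TotalHomology (Omega K X) →ₗ[K] TotalHomology (Omega K X) →ₗ[K]
      TotalHomology (Omega K X)) : Prop :=
  ∃ c, InducedByEZ (Omega K X) (Omega K X) (Omega K (wedge X X)) c ∧
    ∀ (p q : ℕ) (a : Homology (Omega K X) p) (b : Homology (Omega K X) q),
      m (incl _ p a) (incl _ q b) = incl _ (p + q)
        (homologyMap mulMonoidHom (Omega_le_comap K _ (mapsTo_mul_wedge X)) (p + q) (c p q a b))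

/-- `m` is the classical Pontryagin product on `H_*(G)`: on homogeneous elements it is the
composite `H_p(G) ⊗ H_q(G) → H_{p+q}(G × G) → H_{p+q}(G)` of the map induced by the
Eilenberg–Zilber map and the map induced by the multiplication of `G`. -/
def IsClassicalPontryaginProduct [CommGroup G]
    (m : TotalHomology (full K G) →ₗ[K] TotalHomology (full K G) →ₗ[K]
      TotalHomology (full K G)) : Prop :=
  ∃ c, InducedByEZ (full K G) (full K G) (full K (G × G)) c ∧
    ∀ (p q : ℕ) (a : Homology (full K G) p) (b : Homology (full K G) q),
      m (incl _ p a) (incl _ q b) = incl _ (p + q)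
        (homologyMap (W' := full K G) mulMonoidHom (fun _ _ _ => Submodule.mem_top) (p + q)
          (c p q a b))

/-- The bilinear multiplication `m` makes `H_*(W)` a graded-commutative associative graded
`K`-algebra with unit `one`. -/
structure IsGradedCommAlgebra [Group G] {W : GradedSub K G}
    (m : TotalHomology W →ₗ[K] TotalHomology W →ₗ[K] TotalHomology W)
    (one : TotalHomology W) : Prop where
  one_mem : one ∈ LinearMap.range (incl W 0)
  mul_mem : ∀ (p q : ℕ) (a : Homology W p) (b : Homology W q),
    m (incl W p a) (incl W q b) ∈ LinearMap.range (incl W (p + q))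
  one_mul : ∀ a, m one a = a
  mul_one : ∀ a, m a one = a
  mul_assoc : ∀ a b c, m (m a b) c = m a (m b c)
  graded_comm : ∀ (p q : ℕ) (a : Homology W p) (b : Homology W q),
    m (incl W p a) (incl W q b) = (-1 : K) ^ (p * q) • m (incl W q b) (incl W p a)

end Products

end SubsetHomology

end

open SubsetHomology

/-! All the algebra already holds strictly on normalized chains, so no chain homotopies are needed.
The normalized chains of every degree embed into one module, the free module on words in `G` modulo
words containing the letter 1 (`NChain.toWords_injective`). There the degrees no longer appear in
types, and the Eilenberg–Zilber map followed by multiplication becomes the signed shuffle product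
(`toWords_ezChain`, `toWords_chainProduct`), given by the recursion xa ⧢ yb = x(a ⧢ yb) + (-1)^|xa|
y(xa ⧢ b). Associativity and graded commutativity are inductions on words (`shuffle_assoc`,
`shuffleWord_comm`), and the empty word is the unit.

The Leibniz rule is where commutativity enters (`laterFaces_shuffle`). A face of a shuffle that
multiplies a letter x of one word by a letter y of the other also arises, with opposite sign, from
the shuffle in which x and y trade places; the two terms cancel because xy = yx. The remaining faces
are faces of one of the factors. In `G × G'` the letters (g, 1) and (1, g') commute, so the rule
holds for ε over arbitrary groups.

For pointed subsets, every letter of a shuffle of words in X and X' lies in X ∨ X'. With the Leibniz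
rule, ε therefore sends Ω ⊗ Ω to Ω of the wedge (`EZMapsTo.omega`), and products of cycles with
boundaries are boundaries, which gives the products on homology (`EZMapsTo.exists_inducedByEZ`).
Both the subset product and the classical one are determined by `chainProduct` on cycles, so
uniqueness, the algebra laws and naturality are proved once for `InducedByChainProduct`.
Homomorphisms act letter by letter and hence respect shuffles; for X = G the two subcomplexes
coincide and the comparison map is the identity. -/

noncomputable section

namespace SubsetHomology

/-! ### Chains on words -/

section Words

variable (K : Type w) [CommRing K] {H : Type u} {H' : Type v}

variable (H) in
/-- The free module on the words in `H`. -/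
abbrev WordChain : Type (max u w) := List H →₀ K

/-- A word as a chain. -/
abbrev word (l : List H) : WordChain K H := Finsupp.single l 1

/-- Prefixing a letter. -/
def consMap (x : H) : WordChain K H →ₗ[K] WordChain K H :=
  Finsupp.lmapDomain K K (List.cons x)

/-- The map induced on words by a map of letters. -/
def wordMap (f : H → H') : WordChain K H →ₗ[K] WordChain K H' :=
  Finsupp.lmapDomain K K (List.map f)

/-- The involution that multiplies a word of length `n` by `(-1)ⁿ`. -/
def parity : WordChain K H →ₗ[K] WordChain K H :=
  Finsupp.linearCombination K (fun l => (-1 : K) ^ l.length • word K l)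

/-- The signed shuffle product of two words. -/
def shuffleWord : List H → List H → WordChain K H
  | [], b => word K b
  | x :: a, [] => word K (x :: a)
  | x :: a, y :: b => consMap K x (shuffleWord a (y :: b))
      + (-1 : K) ^ (a.length + 1) • consMap K y (shuffleWord (x :: a) b)
termination_by a b => a.length + b.length

/-- The signed shuffle product. -/
def shuffle : WordChain K H →ₗ[K] WordChain K H →ₗ[K] WordChain K H :=
  Finsupp.linearCombination K (fun a => Finsupp.linearCombination K (shuffleWord K a))

@[simp]
theorem consMap_word (x : H) (l : List H) : consMap K x (word K l) = word K (x :: l) := by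
  simp [consMap]

@[simp]
theorem wordMap_word (f : H → H') (l : List H) :
    wordMap K f (word K l) = word K (l.map f) := by
  simp [wordMap]

@[simp]
theorem parity_word (l : List H) : parity K (word K l) = (-1 : K) ^ l.length • word K l := by
  rw [parity, Finsupp.linearCombination_single, one_smul]

@[simp]
theorem shuffle_word (a b : List H) : shuffle K (word K a) (word K b) = shuffleWord K a b := by
  simp [shuffle]

@[simp]
theorem shuffleWord_nil_left (b : List H) : shuffleWord K [] b = word K b := by
  rw [shuffleWord]

@[simp]
theorem shuffleWord_nil_right (a : List H) : shuffleWord K a [] = word K a := by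
  cases a <;> rw [shuffleWord]

variable {K}

theorem linearMap_ext_word {M : Type*} [AddCommGroup M] [Module K M]
    {φ ψ : WordChain K H →ₗ[K] M} (h : ∀ l, φ (word K l) = ψ (word K l)) : φ = ψ :=
  Finsupp.lhom_ext' fun l => LinearMap.ext_ring (h l)

theorem linearMap_ext_word₂ {M : Type*} [AddCommGroup M] [Module K M]
    {φ ψ : WordChain K H →ₗ[K] WordChain K H' →ₗ[K] M}
    (h : ∀ a b, φ (word K a) (word K b) = ψ (word K a) (word K b)) : φ = ψ :=
  linearMap_ext_word fun a => linearMap_ext_word fun b => h a b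

theorem parity_consMap (x : H) (a : WordChain K H) :
    parity K (consMap K x a) = -consMap K x (parity K a) := by
  suffices h : parity K ∘ₗ consMap K x = -(consMap K x ∘ₗ parity K) from LinearMap.congr_fun h a
  refine linearMap_ext_word fun l => ?_
  simp only [LinearMap.comp_apply, LinearMap.neg_apply, consMap_word, parity_word, map_smul,
    List.length_cons, pow_succ]
  module

theorem parity_parity (a : WordChain K H) : parity K (parity K a) = a := by
  suffices h : parity K ∘ₗ parity K = (LinearMap.id : WordChain K H →ₗ[K] _) from
    LinearMap.congr_fun h a
  refine linearMap_ext_word fun l => ?_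
  simp only [LinearMap.comp_apply, parity_word, map_smul, smul_smul, ← pow_add,
    Even.neg_one_pow ⟨l.length, rfl⟩, one_smul, LinearMap.id_apply]

theorem wordMap_consMap (f : H → H') (x : H) (a : WordChain K H) :
    wordMap K f (consMap K x a) = consMap K (f x) (wordMap K f a) := by
  suffices h : wordMap K f ∘ₗ consMap K x = consMap K (f x) ∘ₗ wordMap K f from
    LinearMap.congr_fun h a
  exact linearMap_ext_word fun l => by simp

theorem parity_wordMap (f : H → H') (a : WordChain K H) :
    parity K (wordMap K f a) = wordMap K f (parity K a) := by
  suffices h : parity K ∘ₗ wordMap K f = wordMap K f ∘ₗ parity K from LinearMap.congr_fun h a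
  refine linearMap_ext_word fun l => ?_
  simp only [LinearMap.comp_apply, wordMap_word, parity_word, map_smul, List.length_map]

/-- The linear form of the recursion. The sign is absorbed into `parity`, so later inductions need
not track word lengths. -/
theorem shuffle_consMap_consMap (x y : H) (a b : WordChain K H) :
    shuffle K (consMap K x a) (consMap K y b) = consMap K x (shuffle K a (consMap K y b))
      + consMap K y (shuffle K (parity K (consMap K x a)) b) := by
  suffices h : (shuffle K).compl₁₂ (consMap K x) (consMap K y)
      = ((shuffle K).compl₂ (consMap K y)).compr₂ (consMap K x)
        + ((shuffle K) ∘ₗ (parity K ∘ₗ consMap K x)).compr₂ (consMap K y) from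
    LinearMap.congr_fun₂ h a b
  refine linearMap_ext_word₂ fun a b => ?_
  simp only [LinearMap.compl₁₂_apply, LinearMap.add_apply, LinearMap.compr₂_apply,
    LinearMap.compl₂_apply, LinearMap.comp_apply, consMap_word, parity_word, map_smul,
    LinearMap.smul_apply, shuffle_word, List.length_cons]
  rw [shuffleWord]

@[simp]
theorem shuffle_nil_left (b : WordChain K H) : shuffle K (word K []) b = b := by
  suffices h : shuffle K (word K []) = (LinearMap.id : WordChain K H →ₗ[K] _) from
    LinearMap.congr_fun h b
  exact linearMap_ext_word fun l => by simp

@[simp]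
theorem shuffle_nil_right (a : WordChain K H) : shuffle K a (word K []) = a := by
  suffices h : (shuffle K).flip (word K []) = (LinearMap.id : WordChain K H →ₗ[K] _) from
    LinearMap.congr_fun h a
  exact linearMap_ext_word fun l => by simp

/-- All words in a shuffle of a and b have length |a| + |b|. The associativity proof needs this for
the terms in which a letter of the third factor comes first. -/
theorem parity_shuffle (a b : WordChain K H) :
    parity K (shuffle K a b) = shuffle K (parity K a) (parity K b) := by
  suffices h : (shuffle K).compr₂ (parity K)
      = (shuffle K).compl₁₂ (parity K : WordChain K H →ₗ[K] _) (parity K) from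
    LinearMap.congr_fun₂ h a b
  refine linearMap_ext_word₂ fun a b => ?_
  simp only [LinearMap.compr₂_apply, LinearMap.compl₁₂_apply]
  induction a generalizing b with
  | nil => simp
  | cons x a iha =>
    induction b with
    | nil => simp
    | cons y b ihb =>
      have iha' := iha (y :: b)
      -- On a word `parity` is only a sign, so the induction hypothesis survives inserting it in the
      -- first factor.
      have ihb' : parity K (shuffle K (parity K (word K (x :: a))) (word K b))
          = shuffle K (parity K (parity K (word K (x :: a)))) (parity K (word K b)) := by
        rw [parity_word (K := K) (l := x :: a)]
        simp only [map_smul, LinearMap.smul_apply, ihb]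
      simp only [← consMap_word] at iha' ihb' ⊢
      simp only [parity_consMap, map_neg, LinearMap.neg_apply, shuffle_consMap_consMap, map_add,
        neg_neg, iha', parity_parity] at ihb' ⊢
      rw [← ihb', map_neg, neg_neg]

/-- The leading letter of a triple shuffle comes from the first, second or third word. Each side
splits into these three parts, and the parts agree by induction on the word that lost its leading
letter. -/
theorem shuffle_assoc (a b c : WordChain K H) :
    shuffle K (shuffle K a b) c = shuffle K a (shuffle K b c) := by
  suffices key : ∀ a b c : List H, shuffle K (shuffle K (word K a) (word K b)) (word K c)
      = shuffle K (word K a) (shuffle K (word K b) (word K c)) by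
    have key₁ (a b : List H) : shuffle K (shuffle K (word K a) (word K b)) c
        = shuffle K (word K a) (shuffle K (word K b) c) :=
      LinearMap.congr_fun (linearMap_ext_word
        (φ := shuffle K (shuffle K (word K a) (word K b)))
        (ψ := shuffle K (word K a) ∘ₗ shuffle K (word K b)) (key a b)) c
    exact LinearMap.congr_fun₂ (linearMap_ext_word₂
      (φ := (shuffle K).compr₂ ((shuffle K).flip c))
      (ψ := (shuffle K).compl₂ ((shuffle K).flip c)) key₁) a b
  intro a
  induction a with
  | nil => simp
  | cons x a iha =>
    intro b
    induction b with
    | nil => simp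
    | cons y b ihb =>
      intro c
      induction c with
      | nil => simp
      | cons z c ihc =>
        have ha := iha (y :: b) (z :: c)
        have hb := ihb (z :: c)
        have hb' : shuffle K (shuffle K (parity K (word K (x :: a))) (word K b)) (word K (z :: c))
            = shuffle K (parity K (word K (x :: a))) (shuffle K (word K b) (word K (z :: c))) := by
          simp only [parity_word, map_smul, LinearMap.smul_apply, hb]
        have hc : shuffle K (parity K (shuffle K (word K (x :: a)) (word K (y :: b)))) (word K c)
            = shuffle K (parity K (word K (x :: a)))
                (shuffle K (parity K (word K (y :: b))) (word K c)) := by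
          simp only [parity_shuffle, parity_word, map_smul, LinearMap.smul_apply, ihc]
        simp only [← consMap_word] at ha hb' hc ⊢
        simp only [shuffle_consMap_consMap, map_add, LinearMap.add_apply] at ha hb' hc ⊢
        simp only [ha, hb', ← hc, map_add]
        abel

theorem shuffleWord_comm (a b : List H) :
    shuffleWord K a b = (-1 : K) ^ (a.length * b.length) • shuffleWord K b a := by
  induction a generalizing b with
  | nil => simp
  | cons x a iha =>
    induction b with
    | nil => simp
    | cons y b ihb =>
      rw [shuffleWord, shuffleWord, iha, ihb]
      simp only [map_smul, smul_add, smul_smul, List.length_cons, ← pow_add]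
      rw [add_comm]
      congr 2
      -- One pair of exponents agrees exactly, the other only modulo 2.
      · exact congrArg _ (by ring)
      · rw [neg_one_pow_congr]
        simp only [Nat.even_add, Nat.even_mul, Nat.even_add_one]
        tauto

theorem shuffle_wordMap (f : H → H') (a b : WordChain K H) :
    shuffle K (wordMap K f a) (wordMap K f b) = wordMap K f (shuffle K a b) := by
  suffices h : (shuffle K).compl₁₂ (wordMap K f) (wordMap K f)
      = (shuffle K).compr₂ (wordMap K f) from LinearMap.congr_fun₂ h a b
  refine linearMap_ext_word₂ fun a b => ?_
  simp only [LinearMap.compl₁₂_apply, LinearMap.compr₂_apply, wordMap_word, shuffle_word]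
  induction a generalizing b with
  | nil => simp
  | cons x a iha =>
    induction b with
    | nil => simp
    | cons y b ihb =>
      simp only [List.map_cons] at iha ihb ⊢
      rw [shuffleWord, shuffleWord, map_add, map_smul, wordMap_consMap, wordMap_consMap, ← ihb,
        ← iha, List.map_cons, List.length_map]

/-! ### The bar differential on words -/

variable (K) in
/-- The zeroth face of a word. -/
def firstFace : WordChain K H →ₗ[K] WordChain K H :=
  Finsupp.linearCombination K fun
    | [] => 0
    | _ :: l => word K l

variable [Group H]

variable (K) in
/-- The first face of `x :: l`, as a function of `l`. -/
def mergeMap (x : H) : WordChain K H →ₗ[K] WordChain K H :=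
  Finsupp.linearCombination K fun
    | [] => word K []
    | y :: l => word K ((y * x) :: l)

variable (K) in
/-- The alternating sum of all faces but the zeroth one. -/
def laterFacesWord : List H → WordChain K H
  | [] => 0
  | x :: l => -mergeMap K x (word K l) - consMap K x (laterFacesWord l)

variable (K H) in
/-- The alternating sum of all faces but the zeroth one. -/
def laterFaces : WordChain K H →ₗ[K] WordChain K H :=
  Finsupp.linearCombination K (laterFacesWord K)

variable (K H) in
/-- The bar differential on words. -/
def wordBoundary : WordChain K H →ₗ[K] WordChain K H := firstFace K + laterFaces K H

omit [Group H] in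
@[simp]
theorem firstFace_nil : firstFace K (word K ([] : List H)) = 0 := by simp [firstFace]

omit [Group H] in
@[simp]
theorem firstFace_consMap (x : H) (a : WordChain K H) : firstFace K (consMap K x a) = a := by
  suffices h : firstFace K ∘ₗ consMap K x = LinearMap.id from LinearMap.congr_fun h a
  exact linearMap_ext_word fun l => by simp [firstFace]

-- This value makes the recursion for `laterFacesWord` include the last face: on a one-letter word
-- it deletes the letter.
@[simp]
theorem mergeMap_nil (x : H) : mergeMap K x (word K []) = word K [] := by simp [mergeMap]

@[simp]
theorem mergeMap_consMap (x y : H) (a : WordChain K H) :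
    mergeMap K x (consMap K y a) = consMap K (y * x) a := by
  suffices h : mergeMap K x ∘ₗ consMap K y = consMap K (y * x) from LinearMap.congr_fun h a
  exact linearMap_ext_word fun l => by simp [mergeMap]

@[simp]
theorem laterFaces_nil : laterFaces K H (word K []) = 0 := by
  simp [laterFaces, laterFacesWord]

theorem laterFaces_consMap (x : H) (a : WordChain K H) :
    laterFaces K H (consMap K x a) = -mergeMap K x a - consMap K x (laterFaces K H a) := by
  suffices h : laterFaces K H ∘ₗ consMap K x
      = -mergeMap K x - consMap K x ∘ₗ laterFaces K H from LinearMap.congr_fun h a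
  refine linearMap_ext_word fun l => ?_
  simp [laterFaces, laterFacesWord]

theorem parity_mergeMap (x : H) (a : WordChain K H) :
    parity K (mergeMap K x a) = mergeMap K x (parity K a) := by
  suffices h : parity K ∘ₗ mergeMap K x = mergeMap K x ∘ₗ parity K from LinearMap.congr_fun h a
  refine linearMap_ext_word fun l => ?_
  cases l with
  | nil => simp
  | cons y l =>
    simp only [← consMap_word, LinearMap.comp_apply, mergeMap_consMap, parity_consMap, map_neg]

theorem parity_laterFaces (a : WordChain K H) :
    parity K (laterFaces K H a) = -laterFaces K H (parity K a) := by
  suffices h : parity K ∘ₗ laterFaces K H = -(laterFaces K H ∘ₗ parity K) from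
    LinearMap.congr_fun h a
  refine linearMap_ext_word fun l => ?_
  simp only [LinearMap.comp_apply, LinearMap.neg_apply]
  induction l with
  | nil => simp
  | cons x l ih =>
    simp only [← consMap_word, laterFaces_consMap, parity_consMap, map_sub, map_neg,
      parity_mergeMap, ih]
    abel

/-- If the leading letter of the shuffle comes from a, the letter x is merged into a; this gives the
terms of the first product on the right except those that begin with y, which are subtracted. If the
leading letter is y, it becomes yx. -/
theorem mergeMap_shuffle_left (x y : H) (a b : WordChain K H) :
    mergeMap K x (shuffle K a (consMap K y b)) = shuffle K (mergeMap K x a) (consMap K y b)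
      - consMap K y (shuffle K (parity K (mergeMap K x a)) b)
      + consMap K (y * x) (shuffle K (parity K a) b) := by
  suffices h : ((shuffle K).compl₂ (consMap K y)).compr₂ (mergeMap K x)
        + ((shuffle K : WordChain K H →ₗ[K] _) ∘ₗ (parity K ∘ₗ mergeMap K x)).compr₂ (consMap K y)
      = (shuffle K).compl₁₂ (mergeMap K x) (consMap K y)
        + ((shuffle K : WordChain K H →ₗ[K] _) ∘ₗ parity K).compr₂ (consMap K (y * x)) by
    rw [sub_add_eq_add_sub]
    exact eq_sub_of_add_eq (LinearMap.congr_fun₂ h a b)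
  refine linearMap_ext_word₂ fun a b => ?_
  simp only [LinearMap.compr₂_apply, LinearMap.compl₁₂_apply, LinearMap.compl₂_apply,
    LinearMap.add_apply, LinearMap.comp_apply]
  cases a with
  | nil =>
    simp only [parity_word, List.length_nil, pow_zero, one_smul, mergeMap_nil, shuffle_nil_left,
      mergeMap_consMap]
    abel
  | cons z a =>
    simp only [← consMap_word, shuffle_consMap_consMap, mergeMap_consMap, map_add]
    abel

/-- The mirror image of `mergeMap_shuffle_left`. Here the mixed letter is xy rather than yx; the two
occur with opposite signs in the Leibniz rule. -/
theorem mergeMap_shuffle_right (x y : H) (a b : WordChain K H) :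
    mergeMap K y (shuffle K (consMap K x a) b) = consMap K (x * y) (shuffle K a b)
      + shuffle K (consMap K x a) (mergeMap K y b)
      - consMap K x (shuffle K a (mergeMap K y b)) := by
  suffices h : ((shuffle K) ∘ₗ (consMap K x)).compr₂ (mergeMap K y)
        + ((shuffle K).compl₂ (mergeMap K y)).compr₂ (consMap K x)
      = (shuffle K).compr₂ (consMap K (x * y))
        + (shuffle K).compl₁₂ (consMap K x) (mergeMap K y) by
    exact eq_sub_of_add_eq (LinearMap.congr_fun₂ h a b)
  refine LinearMap.ext fun a => linearMap_ext_word fun b => ?_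
  simp only [LinearMap.compr₂_apply, LinearMap.compl₁₂_apply, LinearMap.compl₂_apply,
    LinearMap.add_apply, LinearMap.comp_apply]
  cases b with
  | nil => simp
  | cons z b =>
    simp only [← consMap_word, shuffle_consMap_consMap, mergeMap_consMap, map_add]
    abel

/-- Merging two neighbours from the same word is a face of that word. Mixed merges come in pairs,
from shuffles that differ by exchanging the two neighbours, and cancel because the letters commute.
-/
theorem laterFaces_shuffle (a b : List H) (hab : ∀ x ∈ a, ∀ y ∈ b, Commute x y) :
    laterFaces K H (shuffle K (word K a) (word K b))
      = shuffle K (laterFaces K H (word K a)) (word K b)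
        + shuffle K (parity K (word K a)) (laterFaces K H (word K b)) := by
  induction a generalizing b with
  | nil => simp [parity]
  | cons x a iha =>
    induction b with
    | nil => simp
    | cons y b ihb =>
      have hxy : x * y = y * x := hab x (by simp) y (by simp)
      have ha := iha (y :: b) fun z hz t ht => hab z (List.mem_cons_of_mem _ hz) t ht
      have hb := ihb fun z hz t ht => hab z hz t (List.mem_cons_of_mem _ ht)
      have hb' : laterFaces K H (shuffle K (parity K (word K (x :: a))) (word K b))
          = shuffle K (laterFaces K H (parity K (word K (x :: a)))) (word K b)
            + shuffle K (parity K (parity K (word K (x :: a)))) (laterFaces K H (word K b)) := by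
        rw [parity_word (K := K) (l := x :: a)]
        simp only [map_smul, LinearMap.smul_apply, hb, smul_add]
      clear iha ihb hb
      simp only [← consMap_word] at ha hb' ⊢
      simp only [shuffle_consMap_consMap, map_add, map_sub, map_neg, LinearMap.sub_apply,
        LinearMap.neg_apply, laterFaces_consMap, parity_consMap,
        parity_mergeMap, parity_laterFaces, mergeMap_shuffle_left, mergeMap_shuffle_right, ha,
        parity_parity, hxy, neg_neg] at ha hb' ⊢
      rw [neg_eq_iff_eq_neg] at hb'
      simp only [hb', map_add, map_sub, map_neg]
      abel

-- Deleting the leading letter leaves exactly the two summands of the shuffle recursion, so no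
-- commutation of letters is involved.
omit [Group H] in
theorem firstFace_shuffle (a b : WordChain K H) :
    firstFace K (shuffle K a b)
      = shuffle K (firstFace K a) b + shuffle K (parity K a) (firstFace K b) := by
  suffices h : (shuffle K).compr₂ (firstFace K)
      = (shuffle K) ∘ₗ (firstFace K)
        + (shuffle K).compl₁₂ (parity K : WordChain K H →ₗ[K] _) (firstFace K) from
    LinearMap.congr_fun₂ h a b
  refine linearMap_ext_word₂ fun a b => ?_
  simp only [LinearMap.compr₂_apply, LinearMap.compl₁₂_apply, LinearMap.add_apply,
    LinearMap.comp_apply]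
  cases a with
  | nil => simp [parity]
  | cons x a =>
    cases b with
    | nil => simp
    | cons y b =>
      simp only [← consMap_word, shuffle_consMap_consMap, map_add, firstFace_consMap]

/-- The Leibniz rule for the shuffle product of words whose letters commute. -/
theorem wordBoundary_shuffle_word (a b : List H) (hab : ∀ x ∈ a, ∀ y ∈ b, Commute x y) :
    wordBoundary K H (shuffle K (word K a) (word K b))
      = shuffle K (wordBoundary K H (word K a)) (word K b)
        + shuffle K (parity K (word K a)) (wordBoundary K H (word K b)) := by
  simp only [wordBoundary, LinearMap.add_apply, firstFace_shuffle, laterFaces_shuffle a b hab,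
    map_add]
  abel

/-- The Leibniz rule for two homomorphisms whose values commute. -/
theorem wordBoundary_shuffle {A B : Type*} {f : A → H} {g : B → H}
    (hfg : ∀ x y, Commute (f x) (g y)) (a : WordChain K A) (b : WordChain K B) :
    wordBoundary K H (shuffle K (wordMap K f a) (wordMap K g b))
      = shuffle K (wordBoundary K H (wordMap K f a)) (wordMap K g b)
        + shuffle K (parity K (wordMap K f a)) (wordBoundary K H (wordMap K g b)) := by
  suffices h : ((shuffle K).compl₁₂ (wordMap K f) (wordMap K g)).compr₂ (wordBoundary K H)
      = (shuffle K).compl₁₂ (wordBoundary K H ∘ₗ wordMap K f) (wordMap K g)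
        + (shuffle K).compl₁₂ (parity K ∘ₗ wordMap K f) (wordBoundary K H ∘ₗ wordMap K g) from
    LinearMap.congr_fun₂ h a b
  refine linearMap_ext_word₂ fun a b => ?_
  simp only [LinearMap.compr₂_apply, LinearMap.compl₁₂_apply, LinearMap.add_apply,
    LinearMap.comp_apply, wordMap_word]
  refine wordBoundary_shuffle_word _ _ fun x hx y hy => ?_
  obtain ⟨x, -, rfl⟩ := List.mem_map.1 hx
  obtain ⟨y, -, rfl⟩ := List.mem_map.1 hy
  exact hfg x y

/-! ### Degenerate words -/

variable (K H) in
/-- The span of the words with a letter equal to `1`. -/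
def degenerateWords : Submodule K (WordChain K H) :=
  Submodule.span K (word K '' {l | (1 : H) ∈ l})

theorem word_mem_degenerateWords {l : List H} (h : 1 ∈ l) :
    word K l ∈ degenerateWords K H := Submodule.subset_span ⟨l, h, rfl⟩

theorem consMap_mem_degenerateWords (x : H) {a : WordChain K H} (ha : a ∈ degenerateWords K H) :
    consMap K x a ∈ degenerateWords K H := by
  suffices h : degenerateWords K H ≤ (degenerateWords K H).comap (consMap K x) from h ha
  refine Submodule.span_le.2 ?_
  rintro _ ⟨l, hl, rfl⟩
  simpa using word_mem_degenerateWords (List.mem_cons_of_mem x hl)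

theorem consMap_one_mem_degenerateWords (a : WordChain K H) :
    consMap K 1 a ∈ degenerateWords K H := by
  induction a using Finsupp.induction_linear with
  | zero => simp
  | add a b ha hb => rw [map_add]; exact add_mem ha hb
  | single l c =>
    rw [← mul_one c, ← smul_eq_mul, ← Finsupp.smul_single, map_smul, consMap_word]
    exact Submodule.smul_mem _ _ (word_mem_degenerateWords (by simp))

/-- Every shuffle contains all letters of both words, so a letter 1 persists. -/
theorem shuffleWord_mem_degenerateWords {a b : List H} (h : 1 ∈ a ∨ 1 ∈ b) :
    shuffleWord K a b ∈ degenerateWords K H := by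
  induction a generalizing b with
  | nil => simpa using word_mem_degenerateWords (by simpa using h)
  | cons x a iha =>
    induction b with
    | nil => simpa using word_mem_degenerateWords (by simpa using h)
    | cons y b ihb =>
      rw [shuffleWord]
      refine add_mem ?_ (Submodule.smul_mem _ _ ?_)
      · by_cases hx : x = 1
        · rw [hx]; exact consMap_one_mem_degenerateWords _
        · refine consMap_mem_degenerateWords _ (iha (h.imp_left fun h => ?_))
          exact (List.mem_cons.1 h).resolve_left (Ne.symm hx)
      · by_cases hy : y = 1
        · rw [hy]; exact consMap_one_mem_degenerateWords _
        · refine consMap_mem_degenerateWords _ (ihb (h.imp_right fun h => ?_))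
          exact (List.mem_cons.1 h).resolve_left (Ne.symm hy)

theorem shuffle_mem_degenerateWords_left {a : WordChain K H} (ha : a ∈ degenerateWords K H)
    (b : WordChain K H) : shuffle K a b ∈ degenerateWords K H := by
  suffices h : degenerateWords K H ≤ (degenerateWords K H).comap ((shuffle K).flip b) from h ha
  refine Submodule.span_le.2 ?_
  rintro _ ⟨l, hl, rfl⟩
  simp only [Submodule.comap_coe, Set.mem_preimage, SetLike.mem_coe, LinearMap.flip_apply]
  induction b using Finsupp.induction_linear with
  | zero => simp
  | add b c hb hc => rw [map_add]; exact add_mem hb hc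
  | single m c =>
    rw [← mul_one c, ← smul_eq_mul, ← Finsupp.smul_single, map_smul, shuffle_word]
    exact Submodule.smul_mem _ _ (shuffleWord_mem_degenerateWords (.inl hl))

theorem shuffle_mem_degenerateWords_right (a : WordChain K H) {b : WordChain K H}
    (hb : b ∈ degenerateWords K H) : shuffle K a b ∈ degenerateWords K H := by
  suffices h : degenerateWords K H ≤ (degenerateWords K H).comap (shuffle K a) from h hb
  refine Submodule.span_le.2 ?_
  rintro _ ⟨l, hl, rfl⟩
  simp only [Submodule.comap_coe, Set.mem_preimage, SetLike.mem_coe]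
  induction a using Finsupp.induction_linear with
  | zero => simp
  | add b c hb hc => rw [map_add]; exact add_mem hb hc
  | single m c =>
    rw [← mul_one c, ← smul_eq_mul, ← Finsupp.smul_single, map_smul, LinearMap.smul_apply,
      shuffle_word]
    exact Submodule.smul_mem _ _ (shuffleWord_mem_degenerateWords (.inr hl))

end Words

/-! ### Shuffles as bijections and the recursive shuffle product -/

section Shuffles

/-- A shuffle of `p` and `q` letters with values in `Fin n`. -/
def ShuffleTo (p q n : ℕ) : Type :=
  {e : Fin p ⊕ Fin q ≃ Fin n //
    StrictMono (fun i => e (Sum.inl i)) ∧ StrictMono (fun j => e (Sum.inr j))}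

instance (p q n : ℕ) : Finite (ShuffleTo p q n) := Subtype.finite

instance (p q n : ℕ) : Fintype (ShuffleTo p q n) := Fintype.ofFinite _

namespace ShuffleTo

variable {p q n : ℕ}

/-- The target size is kept apart from `p + q` so that prefixing a position needs no casts between
`Fin` types; this recovers the relation. -/
theorem card_eq (e : ShuffleTo p q n) : p + q = n := by
  simpa using Fintype.card_congr e.1

/-- The sign of a shuffle, from its inversions. -/
def inversionSign (e : ShuffleTo p q n) : ℤˣ :=
  ∏ j : Fin q, ∏ i : Fin p, if e.1 (Sum.inl i) < e.1 (Sum.inr j) then 1 else -1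

/-- The shuffle of two tuples given by a shuffle of the positions. -/
def merge {H : Type*} (e : ShuffleTo p q n) (g : Fin p → H) (h : Fin q → H) : Fin n → H :=
  fun k => Sum.elim g h (e.1.symm k)

theorem ext_apply {e e' : ShuffleTo p q n} (h₁ : ∀ i, e.1 (Sum.inl i) = e'.1 (Sum.inl i))
    (h₂ : ∀ j, e.1 (Sum.inr j) = e'.1 (Sum.inr j)) : e = e' :=
  Subtype.ext (Equiv.ext (Sum.rec h₁ h₂))

/-- The shuffle that starts with a position of the first kind and goes on as `e`. -/
def consLeft (e : ShuffleTo p q n) : ShuffleTo (p + 1) q (n + 1) :=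
  ⟨Equiv.ofBijective
    (Sum.elim (Fin.cons 0 fun i => (e.1 (Sum.inl i)).succ) fun j => (e.1 (Sum.inr j)).succ) (by
      rw [Fintype.bijective_iff_injective_and_card]
      refine ⟨Function.Injective.sumElim ?_ ?_ ?_, by have := e.card_eq; simp; omega⟩
      · refine Fin.cons_injective_iff.2 ⟨?_, ?_⟩
        · rintro ⟨i, hi⟩
          exact Fin.succ_ne_zero _ hi
        · exact (Fin.succ_injective _).comp e.2.1.injective
      · exact (Fin.succ_injective _).comp e.2.2.injective
      · intro i j
        induction i using Fin.cases with
        | zero => simpa using (Fin.succ_ne_zero _).symm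
        | succ i => simp),
    by
      intro i i' h
      induction i' using Fin.cases with
      | zero => exact absurd h (Fin.not_lt_zero _)
      | succ i' =>
        induction i using Fin.cases with
        | zero => simp
        | succ i => simpa using e.2.1 (Fin.succ_lt_succ_iff.1 h),
    by
      intro j j' h
      simpa using e.2.2 h⟩

/-- Exchange of the two kinds of positions. -/
def swap (e : ShuffleTo p q n) : ShuffleTo q p n :=
  ⟨(Equiv.sumComm _ _).trans e.1, e.2.2, e.2.1⟩

/-- The shuffle that starts with a position of the second kind and goes on as `e`. -/
def consRight (e : ShuffleTo p q n) : ShuffleTo p (q + 1) (n + 1) := e.swap.consLeft.swap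

@[simp]
theorem consLeft_inl_zero (e : ShuffleTo p q n) : e.consLeft.1 (Sum.inl 0) = 0 := rfl

@[simp]
theorem consLeft_inl_succ (e : ShuffleTo p q n) (i : Fin p) :
    e.consLeft.1 (Sum.inl i.succ) = (e.1 (Sum.inl i)).succ := rfl

@[simp]
theorem consLeft_inr (e : ShuffleTo p q n) (j : Fin q) :
    e.consLeft.1 (Sum.inr j) = (e.1 (Sum.inr j)).succ := rfl

@[simp]
theorem consRight_inr_zero (e : ShuffleTo p q n) : e.consRight.1 (Sum.inr 0) = 0 := rfl

@[simp]
theorem consRight_inr_succ (e : ShuffleTo p q n) (j : Fin q) :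
    e.consRight.1 (Sum.inr j.succ) = (e.1 (Sum.inr j)).succ := rfl

@[simp]
theorem consRight_inl (e : ShuffleTo p q n) (i : Fin p) :
    e.consRight.1 (Sum.inl i) = (e.1 (Sum.inl i)).succ := rfl

theorem exists_consLeft_eq (e : ShuffleTo (p + 1) q (n + 1)) (h : e.1 (Sum.inl 0) = 0) :
    ∃ e' : ShuffleTo p q n, e'.consLeft = e := by
  have h₁ (i : Fin p) : e.1 (Sum.inl i.succ) ≠ 0 := fun hi =>
    Fin.succ_ne_zero i (Sum.inl_injective (e.1.injective (hi.trans h.symm)))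
  have h₂ (j : Fin q) : e.1 (Sum.inr j) ≠ 0 := fun hj =>
    Sum.inr_ne_inl (e.1.injective (hj.trans h.symm))
  refine ⟨⟨Equiv.ofBijective
    (Sum.elim (fun i => (e.1 (Sum.inl i.succ)).pred (h₁ i))
      fun j => (e.1 (Sum.inr j)).pred (h₂ j)) ?_, ?_, ?_⟩, ?_⟩
  · rw [Fintype.bijective_iff_injective_and_card]
    refine ⟨Function.Injective.sumElim ?_ ?_ ?_, by have := e.card_eq; simp; omega⟩
    · intro i i' hi
      simpa using hi
    · intro i i' hi
      simpa using hi
    · intro i j hi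
      simp at hi
  · intro i i' hi
    simpa using e.2.1 (Fin.succ_lt_succ_iff.2 hi)
  · intro j j' hj
    simpa using e.2.2 hj
  · refine ext_apply (fun i => ?_) fun j => ?_
    · induction i using Fin.cases with
      | zero => exact h.symm
      | succ i => exact Fin.succ_pred _ (h₁ i)
    · exact Fin.succ_pred _ (h₂ j)

/-- Position 0 is taken by the first letter of one of the two kinds. This dichotomy is the recursion
of `shuffleWord`. -/
theorem bijective_consLeft_consRight :
    Function.Bijective (Sum.elim consLeft consRight :
      ShuffleTo p (q + 1) n ⊕ ShuffleTo (p + 1) q n → ShuffleTo (p + 1) (q + 1) (n + 1)) := by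
  constructor
  · refine Function.Injective.sumElim ?_ ?_ ?_
    · intro e e' h
      refine ext_apply (fun i => ?_) fun j => ?_
      · simpa using DFunLike.congr_fun (congrArg Subtype.val h) (Sum.inl i.succ)
      · simpa using DFunLike.congr_fun (congrArg Subtype.val h) (Sum.inr j)
    · intro e e' h
      refine ext_apply (fun i => ?_) fun j => ?_
      · simpa using DFunLike.congr_fun (congrArg Subtype.val h) (Sum.inl i)
      · simpa using DFunLike.congr_fun (congrArg Subtype.val h) (Sum.inr j.succ)
    · intro e e' h
      simpa using (DFunLike.congr_fun (congrArg Subtype.val h) (Sum.inl 0)).symm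
  · intro e
    -- Whatever letter sits at position 0 is, by monotonicity, the first of its kind.
    rcases hk : e.1.symm 0 with i | j
    · have h0 : e.1 (Sum.inl i) = 0 := by rw [← hk, Equiv.apply_symm_apply]
      have h : e.1 (Sum.inl 0) = 0 :=
        le_antisymm ((e.2.1.monotone (Fin.zero_le i)).trans h0.le) (Fin.zero_le _)
      obtain ⟨e', rfl⟩ := e.exists_consLeft_eq h
      exact ⟨Sum.inl e', rfl⟩
    · have h0 : e.1 (Sum.inr j) = 0 := by rw [← hk, Equiv.apply_symm_apply]
      have h : e.1 (Sum.inr 0) = 0 :=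
        le_antisymm ((e.2.2.monotone (Fin.zero_le j)).trans h0.le) (Fin.zero_le _)
      obtain ⟨e', he'⟩ := e.swap.exists_consLeft_eq h
      refine ⟨Sum.inr e'.swap, ?_⟩
      change e'.consLeft.swap = e
      rw [he']
      exact ext_apply (fun _ => rfl) fun _ => rfl

theorem inversionSign_consLeft (e : ShuffleTo p q n) :
    e.consLeft.inversionSign = e.inversionSign := by
  simp [inversionSign, Fin.prod_univ_succ]

/-- The new leading letter of the second kind precedes all p letters of the first kind and so adds p
inversions; a leading letter of the first kind adds none. -/
theorem inversionSign_consRight (e : ShuffleTo p q n) :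
    e.consRight.inversionSign = (-1) ^ p * e.inversionSign := by
  simp [inversionSign, Fin.prod_univ_succ]

theorem merge_apply {H : Type*} (e : ShuffleTo p q n) (g : Fin p → H) (h : Fin q → H)
    (s : Fin p ⊕ Fin q) : e.merge g h (e.1 s) = Sum.elim g h s := by
  simp [merge]

theorem ofFn_merge_consLeft {H : Type*} (e : ShuffleTo p q n) (g : Fin (p + 1) → H)
    (h : Fin q → H) :
    List.ofFn (e.consLeft.merge g h) = g 0 :: List.ofFn (e.merge (fun i => g i.succ) h) := by
  rw [List.ofFn_succ]
  congr 1
  · exact e.consLeft.merge_apply g h (Sum.inl 0)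
  · congr 1
    funext k
    obtain ⟨s, rfl⟩ := e.1.surjective k
    rw [merge_apply]
    rcases s with i | j
    · exact e.consLeft.merge_apply g h (Sum.inl i.succ)
    · exact e.consLeft.merge_apply g h (Sum.inr j)

theorem ofFn_merge_consRight {H : Type*} (e : ShuffleTo p q n) (g : Fin p → H)
    (h : Fin (q + 1) → H) :
    List.ofFn (e.consRight.merge g h) = h 0 :: List.ofFn (e.merge g (fun j => h j.succ)) := by
  rw [List.ofFn_succ]
  congr 1
  · exact e.consRight.merge_apply g h (Sum.inr 0)
  · congr 1
    funext k
    obtain ⟨s, rfl⟩ := e.1.surjective k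
    rw [merge_apply]
    rcases s with i | j
    · exact e.consRight.merge_apply g h (Sum.inl i)
    · exact e.consRight.merge_apply g h (Sum.inr j.succ)

/-- A strictly increasing bijection of `Fin n` is the identity. -/
theorem strictMono_bijective_eq {f : Fin n → Fin n} (hf : StrictMono f) : f = id := by
  refine (StrictMono.range_inj hf strictMono_id).1 ?_
  rw [(Finite.injective_iff_surjective.1 hf.injective).range_eq, Set.range_id]

/-- The only shuffle with no position of the second kind. -/
def onlyLeft (n : ℕ) : ShuffleTo n 0 n :=
  ⟨Equiv.sumEmpty _ _, strictMono_id, fun j => j.elim0⟩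

/-- The only shuffle with no position of the first kind. -/
def onlyRight (n : ℕ) : ShuffleTo 0 n n :=
  ⟨Equiv.emptySum _ _, fun i => i.elim0, strictMono_id⟩

theorem eq_onlyLeft (e : ShuffleTo n 0 n) : e = onlyLeft n :=
  ext_apply (fun i => congrFun (strictMono_bijective_eq e.2.1) i) fun j => j.elim0

theorem eq_onlyRight (e : ShuffleTo 0 n n) : e = onlyRight n :=
  ext_apply (fun i => i.elim0) fun j => congrFun (strictMono_bijective_eq e.2.2) j

/-- Sorting the shuffles by their leading letter shows that the sum obeys the recursion of
`shuffleWord`, signs included. -/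
theorem sum_eq_shuffleWord (K : Type*) [CommRing K] {H : Type*} (hn : p + q = n)
    (g : Fin p → H) (h : Fin q → H) :
    ∑ e : ShuffleTo p q n, ((e.inversionSign : ℤ) : K) • word K (List.ofFn (e.merge g h))
      = shuffleWord K (List.ofFn g) (List.ofFn h) := by
  induction n generalizing p q with
  | zero =>
    obtain ⟨rfl, rfl⟩ : p = 0 ∧ q = 0 := by omega
    rw [Fintype.sum_eq_single (onlyLeft 0) fun e he => absurd e.eq_onlyLeft he]
    simp [inversionSign]
  | succ n ih =>
    match p, q with
    | 0, q =>
      obtain rfl : q = n + 1 := by omega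
      rw [Fintype.sum_eq_single (onlyRight _) fun e he => absurd e.eq_onlyRight he]
      simp [inversionSign]
      rfl
    | p + 1, 0 =>
      obtain rfl : p = n := by omega
      rw [Fintype.sum_eq_single (onlyLeft _) fun e he => absurd e.eq_onlyLeft he]
      simp [inversionSign]
      rfl
    | p + 1, q + 1 =>
      rw [← bijective_consLeft_consRight.sum_comp, Fintype.sum_sum_type, List.ofFn_succ,
        List.ofFn_succ, shuffleWord, ← List.ofFn_succ (f := h), ← List.ofFn_succ (f := g),
        ← ih (by omega), ← ih (by omega)]
      simp only [Sum.elim_inl, Sum.elim_inr, inversionSign_consLeft, inversionSign_consRight,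
        ofFn_merge_consLeft, ofFn_merge_consRight, map_sum, map_smul, consMap_word,
        Finset.smul_sum, smul_smul, List.length_ofFn]
      congr 2
      simp

end ShuffleTo

/-- The sign is a product over pairs of positions. Pairs inside one block are never inverted, since
the shuffle is increasing there, so only mixed pairs contribute. -/
theorem sign_finSumFinEquiv_symm_trans {p q : ℕ} (e : Fin p ⊕ Fin q ≃ Fin (p + q))
    (h₁ : StrictMono (fun i => e (Sum.inl i))) (h₂ : StrictMono (fun j => e (Sum.inr j))) :
    Equiv.Perm.sign (finSumFinEquiv.symm.trans e)
      = ∏ j : Fin q, ∏ i : Fin p, if e (Sum.inl i) < e (Sum.inr j) then 1 else -1 := by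
  rw [Equiv.Perm.sign_eq_prod_prod_Iio, Fin.prod_univ_add, Finset.prod_eq_one, one_mul]
  · refine Finset.prod_congr rfl fun j _ => ?_
    rw [← Finset.filter_gt_eq_Iio, Finset.prod_filter, Fin.prod_univ_add]
    have h (i : Fin p) : Fin.castAdd q i < Fin.natAdd p j := by
      simp only [Fin.lt_def, Fin.val_castAdd, Fin.val_natAdd]
      omega
    have h' : ∏ i : Fin q, (if Fin.natAdd p i < Fin.natAdd p j then
        (if (finSumFinEquiv.symm.trans e) (Fin.natAdd p i)
          < (finSumFinEquiv.symm.trans e) (Fin.natAdd p j) then 1 else -1 : ℤˣ) else 1) = 1 := by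
      refine Finset.prod_eq_one fun i _ => ?_
      split_ifs with hij hij'
      · rfl
      · refine absurd ?_ hij'
        simpa using h₂ ((Fin.strictMono_natAdd p).lt_iff_lt.1 hij)
      · rfl
    rw [h', mul_one]
    simp [h]
  · intro j _
    refine Finset.prod_eq_one fun i hi => if_pos ?_
    have hij := Finset.mem_Iio.1 hi
    induction i using Fin.addCases with
    | left i => simpa using h₁ ((Fin.strictMono_castAdd q).lt_iff_lt.1 hij)
    | right i =>
      simp only [Fin.lt_def, Fin.val_castAdd, Fin.val_natAdd] at hij
      omega

theorem Shuffle.sgn_eq_inversionSign {p q : ℕ} (e : Shuffle p q) :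
    e.sgn = ShuffleTo.inversionSign (p := p) (q := q) (n := p + q) e :=
  sign_finSumFinEquiv_symm_trans e.1 e.2.1 e.2.2

end Shuffles

/-! ### The normalized bar complex in terms of words -/

section NormalizedWords

variable (K : Type w) [CommRing K] {G : Type u} [Group G] {G' : Type v} [Group G']

/-- A chain of `K[nerve G]` as a chain on words. -/
def toWords (n : ℕ) : Chain K G n →ₗ[K] WordChain K G :=
  Finsupp.lmapDomain K K List.ofFn

omit [Group G] in
@[simp]
theorem toWords_single {n : ℕ} (g : Fin n → G) (c : K) :
    toWords K n (Finsupp.single g c) = c • word K (List.ofFn g) := by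
  simp [toWords]

omit [Group G] in
variable {K} in
theorem chain_ext {n : ℕ} {M : Type*} [AddCommGroup M] [Module K M] {φ ψ : Chain K G n →ₗ[K] M}
    (h : ∀ g, φ (Finsupp.single g 1) = ψ (Finsupp.single g 1)) : φ = ψ :=
  Finsupp.lhom_ext' fun g => LinearMap.ext_ring (h g)

/-- Face 1 merges the first two letters; every later face keeps the first letter and is a face of
the tail with index lowered by one, hence with opposite sign. -/
theorem sum_faces_succ {n : ℕ} (g : Fin (n + 1) → G) :
    ∑ k : Fin (n + 1), (-1 : K) ^ ((k : ℕ) + 1) • word K (List.ofFn (face k.succ g))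
      = laterFaces K G (word K (List.ofFn g)) := by
  induction n with
  | zero =>
    rw [List.ofFn_succ, ← consMap_word, laterFaces_consMap]
    simp
  | succ n ih =>
    rw [List.ofFn_succ, ← consMap_word, laterFaces_consMap, ← ih, Fin.sum_univ_succ]
    have h₂ : mergeMap K (g 0) (word K (List.ofFn fun i : Fin (n + 1) => g i.succ))
        = word K ((g (Fin.succ 0) * g 0) :: List.ofFn (fun i : Fin n => g i.succ.succ)) := by
      rw [List.ofFn_succ, ← consMap_word, mergeMap_consMap, consMap_word]
    have h₀ : List.ofFn (face (Fin.succ 0) g)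
        = (g (Fin.succ 0) * g 0) :: List.ofFn (fun i : Fin n => g i.succ.succ) := by
      rw [List.ofFn_succ]
      simp [face]
    have h₁ (k : Fin (n + 1)) : List.ofFn (face k.succ.succ g)
        = g 0 :: List.ofFn (face k.succ fun i => g i.succ) := by
      rw [List.ofFn_succ]
      congr 2
      funext i
      simp [face]
    simp only [h₀, h₁, h₂, map_sum, map_smul, consMap_word, Fin.val_succ, pow_succ (-1 : K) (_ + 1)]
    simp [sub_eq_add_neg]

theorem wordBoundary_toWords (n : ℕ) (x : Chain K G (n + 1)) :
    wordBoundary K G (toWords K (n + 1) x) = toWords K n (boundary K G n x) := by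
  suffices h : wordBoundary K G ∘ₗ toWords K (n + 1) = toWords K n ∘ₗ boundary K G n from
    LinearMap.congr_fun h x
  refine chain_ext fun g => ?_
  simp only [LinearMap.comp_apply, toWords_single, one_smul, boundary,
    Finsupp.linearCombination_single, map_sum]
  rw [Fin.sum_univ_succ, wordBoundary, LinearMap.add_apply, ← sum_faces_succ, List.ofFn_succ,
    ← consMap_word, firstFace_consMap]
  have h : face 0 g = fun i => g i.succ := by
    funext i
    simp [face]
  simp [h]

theorem wordBoundary_toWords_zero (x : Chain K G 0) : wordBoundary K G (toWords K 0 x) = 0 := by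
  suffices h : wordBoundary K G ∘ₗ toWords K 0 = 0 from LinearMap.congr_fun h x
  refine chain_ext fun g => ?_
  simp [wordBoundary]

omit [Group G] in
theorem parity_toWords (n : ℕ) (x : Chain K G n) :
    parity K (toWords K n x) = (-1 : K) ^ n • toWords K n x := by
  suffices h : parity K ∘ₗ toWords K n = (-1 : K) ^ n • toWords K n (G := G) from
    LinearMap.congr_fun h x
  refine chain_ext fun g => ?_
  simp only [LinearMap.comp_apply, LinearMap.smul_apply, toWords_single, one_smul, parity_word,
    List.length_ofFn]

theorem mergeMap_wordMap (f : G →* G') (x : G) (a : WordChain K G) :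
    mergeMap K (f x) (wordMap K f a) = wordMap K f (mergeMap K x a) := by
  suffices h : mergeMap K (f x) ∘ₗ wordMap K f = wordMap K f ∘ₗ mergeMap K x from
    LinearMap.congr_fun h a
  refine linearMap_ext_word fun l => ?_
  cases l with
  | nil => simp
  | cons y l =>
    simp only [← consMap_word, LinearMap.comp_apply, wordMap_consMap, mergeMap_consMap, map_mul]

theorem wordBoundary_wordMap (f : G →* G') (a : WordChain K G) :
    wordBoundary K G' (wordMap K f a) = wordMap K f (wordBoundary K G a) := by
  suffices h : wordBoundary K G' ∘ₗ wordMap K f = wordMap K f ∘ₗ wordBoundary K G from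
    LinearMap.congr_fun h a
  refine linearMap_ext_word fun l => ?_
  have h : laterFaces K G' (wordMap K f (word K l)) = wordMap K f (laterFaces K G (word K l)) := by
    induction l with
    | nil => simp
    | cons x l ih =>
      simp only [← consMap_word, laterFaces_consMap, wordMap_consMap, mergeMap_wordMap, ih,
        map_sub, map_neg]
  simp only [LinearMap.comp_apply, wordBoundary, LinearMap.add_apply, map_add, h]
  cases l with
  | nil => simp
  | cons x l => simp only [← consMap_word, wordMap_consMap, firstFace_consMap]

theorem toWords_chainMap (f : G →* G') (n : ℕ) (x : Chain K G n) :
    toWords K n (chainMap K f n x) = wordMap K f (toWords K n x) := by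
  suffices h : toWords K n ∘ₗ chainMap K f n = wordMap K f ∘ₗ toWords K n from
    LinearMap.congr_fun h x
  refine chain_ext fun g => ?_
  simp [chainMap, List.map_ofFn, Function.comp_def]

omit [Group G] in
theorem shuffle_toWords_comm (p q : ℕ) (x : Chain K G p) (y : Chain K G q) :
    shuffle K (toWords K p x) (toWords K q y)
      = (-1 : K) ^ (p * q) • shuffle K (toWords K q y) (toWords K p x) := by
  suffices h : (shuffle K).compl₁₂ (toWords K p (G := G)) (toWords K q)
      = (-1 : K) ^ (p * q) • ((shuffle K).compl₁₂ (toWords K q (G := G)) (toWords K p)).flip from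
    LinearMap.congr_fun₂ h x y
  refine chain_ext fun g => chain_ext fun h => ?_
  simp only [LinearMap.compl₁₂_apply, LinearMap.smul_apply, LinearMap.flip_apply, toWords_single,
    one_smul, shuffle_word]
  rw [shuffleWord_comm]
  simp only [List.length_ofFn]

/-- At each position one of the two degeneracies has the entry 1, so the pair is (gᵢ, 1) or (1, hⱼ).
The tuple is thus a shuffle of the images of the two words under the inclusions of the factors. -/
theorem toWords_ezChain (p q : ℕ) (x : Chain K G p) (y : Chain K G' q) :
    toWords K (p + q) (ezChain K p q x y)
      = shuffle K (wordMap K (MonoidHom.inl G G') (toWords K p x))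
          (wordMap K (MonoidHom.inr G G') (toWords K q y)) := by
  suffices h : (ezChain K p q).compr₂ (toWords K (p + q))
      = (shuffle K).compl₁₂ (wordMap K (MonoidHom.inl G G') ∘ₗ toWords K p)
          (wordMap K (MonoidHom.inr G G') ∘ₗ toWords K q) from LinearMap.congr_fun₂ h x y
  refine chain_ext fun g => chain_ext fun h => ?_
  simp only [LinearMap.compr₂_apply, LinearMap.compl₁₂_apply, LinearMap.comp_apply,
    toWords_single, one_smul, wordMap_word, shuffle_word, List.map_ofFn, ezChain,
    Finsupp.linearCombination_single, map_sum]
  rw [← ShuffleTo.sum_eq_shuffleWord K rfl]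
  refine Fintype.sum_equiv (Equiv.refl _) _ _ fun e => ?_
  rw [Shuffle.sgn_eq_inversionSign]
  congr 3
  funext k
  obtain ⟨s, rfl⟩ := e.1.surjective k
  refine Eq.trans ?_ (ShuffleTo.merge_apply (n := p + q) e _ _ s).symm
  simp only [Shuffle.degenLeft, Shuffle.degenRight, Equiv.symm_apply_apply]
  rcases s with i | j <;> simp

/-! ### The normalized chains on words -/

variable (G) in
/-- Chains on words modulo degenerate ones. -/
abbrev NWordChain : Type (max u w) := WordChain K G ⧸ degenerateWords K G

theorem toWords_mem_degenerateWords {n : ℕ} {x : Chain K G n} (hx : x ∈ degenerate K G n) :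
    toWords K n x ∈ degenerateWords K G := by
  suffices h : degenerate K G n ≤ (degenerateWords K G).comap (toWords K n) from h hx
  refine Submodule.span_le.2 ?_
  rintro _ ⟨g, ⟨i, hi⟩, rfl⟩
  simpa using word_mem_degenerateWords ((List.mem_ofFn' _ _).2 ⟨i, hi⟩)

theorem wordBoundary_mem_degenerateWords {x : WordChain K G} (hx : x ∈ degenerateWords K G) :
    wordBoundary K G x ∈ degenerateWords K G := by
  suffices h : degenerateWords K G ≤ (degenerateWords K G).comap (wordBoundary K G) from h hx
  refine Submodule.span_le.2 ?_
  rintro _ ⟨l, hl, rfl⟩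
  simp only [Submodule.comap_coe, Set.mem_preimage, SetLike.mem_coe]
  -- A word containing 1 is nonempty, so the claim reduces to the one for `boundary` in a positive
  -- degree.
  obtain ⟨n, g, rfl⟩ : ∃ (n : ℕ) (g : Fin (n + 1) → G), List.ofFn g = l := by
    cases l with
    | nil => simp at hl
    | cons x l => exact ⟨l.length, (x :: l).get, List.ofFn_get _⟩
  obtain ⟨i, hi⟩ := (List.mem_ofFn' _ _).1 hl
  have h := wordBoundary_toWords K n (Finsupp.single g 1)
  rw [toWords_single, one_smul] at h
  rw [h]
  exact toWords_mem_degenerateWords K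
    (degenerate_le_comap_boundary K G n (single_mem_degenerate hi 1))

theorem wordMap_mem_degenerateWords (f : G →* G') {x : WordChain K G}
    (hx : x ∈ degenerateWords K G) : wordMap K f x ∈ degenerateWords K G' := by
  suffices h : degenerateWords K G ≤ (degenerateWords K G').comap (wordMap K f) from h hx
  refine Submodule.span_le.2 ?_
  rintro _ ⟨l, hl, rfl⟩
  simpa using word_mem_degenerateWords (List.mem_map.2 ⟨1, hl, map_one f⟩)

variable (G) in
/-- The differential of normalized chains on words. -/
def nWordBoundary : NWordChain K G →ₗ[K] NWordChain K G :=
  (degenerateWords K G).mapQ _ (wordBoundary K G)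
    (fun _ hx => wordBoundary_mem_degenerateWords K hx)

/-- The map of normalized chains on words induced by a homomorphism. -/
def nWordMap (f : G →* G') : NWordChain K G →ₗ[K] NWordChain K G' :=
  (degenerateWords K G).mapQ _ (wordMap K f) (fun _ hx => wordMap_mem_degenerateWords K f hx)

/-- The shuffle product of normalized chains on words. -/
def nShuffle : NWordChain K G →ₗ[K] NWordChain K G →ₗ[K] NWordChain K G :=
  ((degenerateWords K G).liftQ
    ((degenerateWords K G).liftQ ((shuffle K).compr₂ (degenerateWords K G).mkQ)
      (fun _ ha => LinearMap.ext fun b =>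
        (Submodule.Quotient.mk_eq_zero _).2 (shuffle_mem_degenerateWords_left ha b))).flip
    (fun _ hb => LinearMap.ext fun a => by
      obtain ⟨a, rfl⟩ := Submodule.mkQ_surjective _ a
      exact (Submodule.Quotient.mk_eq_zero _).2 (shuffle_mem_degenerateWords_right a hb))).flip

theorem nShuffle_mk_mk (a b : WordChain K G) :
    nShuffle K ((degenerateWords K G).mkQ a) ((degenerateWords K G).mkQ b)
      = (degenerateWords K G).mkQ (shuffle K a b) := rfl

theorem nWordBoundary_mk (a : WordChain K G) :
    nWordBoundary K G ((degenerateWords K G).mkQ a)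
      = (degenerateWords K G).mkQ (wordBoundary K G a) := rfl

theorem nWordMap_mk (f : G →* G') (a : WordChain K G) :
    nWordMap K f ((degenerateWords K G).mkQ a) = (degenerateWords K G').mkQ (wordMap K f a) := rfl

theorem nShuffle_assoc (a b c : NWordChain K G) :
    nShuffle K (nShuffle K a b) c = nShuffle K a (nShuffle K b c) := by
  obtain ⟨a, rfl⟩ := Submodule.mkQ_surjective _ a
  obtain ⟨b, rfl⟩ := Submodule.mkQ_surjective _ b
  obtain ⟨c, rfl⟩ := Submodule.mkQ_surjective _ c
  simp only [nShuffle_mk_mk, shuffle_assoc]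

theorem nShuffle_nWordMap (f : G →* G') (a b : NWordChain K G) :
    nShuffle K (nWordMap K f a) (nWordMap K f b) = nWordMap K f (nShuffle K a b) := by
  obtain ⟨a, rfl⟩ := Submodule.mkQ_surjective _ a
  obtain ⟨b, rfl⟩ := Submodule.mkQ_surjective _ b
  simp only [nShuffle_mk_mk, nWordMap_mk, shuffle_wordMap]

variable {K}

/-- The embedding of `Nₙ G` in the normalized chains on words. -/
def NChain.toWords (n : ℕ) : NChain K G n →ₗ[K] NWordChain K G :=
  NChain.lift ((degenerateWords K G).mkQ ∘ₗ SubsetHomology.toWords K n)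
    (fun _ hx => (Submodule.Quotient.mk_eq_zero _).2 (toWords_mem_degenerateWords K hx))

theorem NChain.toWords_proj (n : ℕ) (x : Chain K G n) :
    NChain.toWords n (proj K G n x) = (degenerateWords K G).mkQ (SubsetHomology.toWords K n x) :=
  rfl

/-- Identities and memberships for chains can therefore be checked on words, where `p + q + r` and
`p + (q + r)` need no transport. -/
theorem NChain.toWords_injective (n : ℕ) :
    Function.Injective (NChain.toWords n : NChain K G n →ₗ[K] NWordChain K G) := by
  -- The left inverse: words of length n are read as simplices, words of any other length go to 0.
  let φ : WordChain K G →ₗ[K] NChain K G n := Finsupp.linearCombination K fun l =>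
    if h : l.length = n then simplex K (fun i : Fin n => l.get (i.cast h.symm)) else 0
  have hφ (l : List G) : φ (word K l)
      = if h : l.length = n then simplex K (fun i : Fin n => l.get (i.cast h.symm)) else 0 := by
    simp [φ]
  have h : degenerateWords K G ≤ LinearMap.ker φ := by
    refine Submodule.span_le.2 ?_
    rintro _ ⟨l, hl, rfl⟩
    simp only [SetLike.mem_coe, LinearMap.mem_ker, hφ]
    split_ifs with hn
    · subst hn
      obtain ⟨i, hi⟩ := List.get_of_mem hl
      exact (proj_eq_zero_iff K G).2 (single_mem_degenerate (i := i) hi 1)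
    · rfl
  refine Function.LeftInverse.injective (g := (degenerateWords K G).liftQ φ h) fun x => ?_
  obtain ⟨x, rfl⟩ := proj_surjective K G n x
  rw [NChain.toWords_proj]
  suffices hx : φ ∘ₗ SubsetHomology.toWords K n = proj K G n from LinearMap.congr_fun hx x
  refine chain_ext fun g => ?_
  rw [LinearMap.comp_apply, toWords_single, one_smul, hφ, dif_pos List.length_ofFn]
  simp [simplex]

theorem NChain.toWords_d (n : ℕ) (x : NChain K G (n + 1)) :
    NChain.toWords n (d K G n x) = nWordBoundary K G (NChain.toWords (n + 1) x) := by
  obtain ⟨x, rfl⟩ := proj_surjective K G _ x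
  rw [d, NChain.lift_proj, LinearMap.comp_apply, NChain.toWords_proj, NChain.toWords_proj,
    nWordBoundary_mk, wordBoundary_toWords]

theorem nWordBoundary_toWords_zero (x : NChain K G 0) :
    nWordBoundary K G (NChain.toWords 0 x) = 0 := by
  obtain ⟨x, rfl⟩ := proj_surjective K G _ x
  rw [NChain.toWords_proj, nWordBoundary_mk, wordBoundary_toWords_zero, map_zero]

theorem NChain.toWords_nMap (f : G →* G') (n : ℕ) (x : NChain K G n) :
    NChain.toWords n (nMap K f n x) = nWordMap K f (NChain.toWords n x) := by
  obtain ⟨x, rfl⟩ := proj_surjective K G _ x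
  rw [nMap, NChain.lift_proj, LinearMap.comp_apply, NChain.toWords_proj, NChain.toWords_proj,
    nWordMap_mk, toWords_chainMap]

theorem NChain.toWords_ez (p q : ℕ) (x : NChain K G p) (y : NChain K G' q) :
    NChain.toWords (p + q) (ez K p q x y)
      = nShuffle K (nWordMap K (MonoidHom.inl G G') (NChain.toWords p x))
          (nWordMap K (MonoidHom.inr G G') (NChain.toWords q y)) := by
  obtain ⟨x, rfl⟩ := proj_surjective K G _ x
  obtain ⟨y, rfl⟩ := proj_surjective K G' _ y
  simp only [ez_proj_proj, NChain.toWords_proj, nWordMap_mk, nShuffle_mk_mk, toWords_ezChain]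

theorem nShuffle_toWords_comm (p q : ℕ) (x : NChain K G p) (y : NChain K G q) :
    nShuffle K (NChain.toWords p x) (NChain.toWords q y)
      = (-1 : K) ^ (p * q) • nShuffle K (NChain.toWords q y) (NChain.toWords p x) := by
  obtain ⟨x, rfl⟩ := proj_surjective K G _ x
  obtain ⟨y, rfl⟩ := proj_surjective K G _ y
  simp only [NChain.toWords_proj, nShuffle_mk_mk, shuffle_toWords_comm K p q x y, map_smul]

theorem NChain.toWords_vertex :
    NChain.toWords 0 (simplex K (fun i : Fin 0 => i.elim0) : NChain K G 0)
      = (degenerateWords K G).mkQ (word K []) := by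
  rw [simplex, NChain.toWords_proj, toWords_single, one_smul, List.ofFn_zero]

theorem nShuffle_nil_left (a : NWordChain K G) :
    nShuffle K ((degenerateWords K G).mkQ (word K [])) a = a := by
  obtain ⟨a, rfl⟩ := Submodule.mkQ_surjective _ a
  rw [nShuffle_mk_mk, shuffle_nil_left]

theorem nShuffle_nil_right (a : NWordChain K G) :
    nShuffle K a ((degenerateWords K G).mkQ (word K [])) = a := by
  obtain ⟨a, rfl⟩ := Submodule.mkQ_surjective _ a
  rw [nShuffle_mk_mk, shuffle_nil_right]

/-- The Leibniz rule for the Eilenberg–Zilber map. -/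
theorem nWordBoundary_toWords_ez (p q : ℕ) (x : NChain K G p) (y : NChain K G' q) :
    nWordBoundary K (G × G') (NChain.toWords (p + q) (ez K p q x y))
      = nShuffle K (nWordMap K (MonoidHom.inl G G') (nWordBoundary K G (NChain.toWords p x)))
          (nWordMap K (MonoidHom.inr G G') (NChain.toWords q y))
        + (-1 : K) ^ p • nShuffle K (nWordMap K (MonoidHom.inl G G') (NChain.toWords p x))
          (nWordMap K (MonoidHom.inr G G') (nWordBoundary K G' (NChain.toWords q y))) := by
  have hc (g : G) (g' : G') : Commute (MonoidHom.inl G G' g) (MonoidHom.inr G G' g') := by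
    simp [Commute, SemiconjBy]
  obtain ⟨x, rfl⟩ := proj_surjective K G _ x
  obtain ⟨y, rfl⟩ := proj_surjective K G' _ y
  rw [NChain.toWords_ez]
  simp only [NChain.toWords_proj, nWordMap_mk, nShuffle_mk_mk, nWordBoundary_mk]
  rw [← LinearMap.map_smul, ← map_add]
  rw [wordBoundary_shuffle hc, parity_wordMap, parity_toWords, wordBoundary_wordMap,
    wordBoundary_wordMap, map_smul, map_smul, LinearMap.smul_apply]

end NormalizedWords

/-! ### Products induced by the Eilenberg–Zilber map -/

section EZProducts

variable {K : Type w} [CommRing K] {G : Type u} [Group G] {G' : Type v} [Group G']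

/-- The normalized chains on words that come from the degree `n` part of `W`. -/
def wordSub (W : GradedSub K G) (n : ℕ) : Submodule K (NWordChain K G) :=
  (W n).map (NChain.toWords n)

theorem toWords_mem_wordSub {W : GradedSub K G} {n : ℕ} {x : NChain K G n} :
    NChain.toWords n x ∈ wordSub W n ↔ x ∈ W n :=
  (NChain.toWords_injective n).mem_set_image

/-- The word boundary vanishes in degree 0, so one condition covers both cases of `cycles`. -/
theorem mem_cycles_iff {W : GradedSub K G} {n : ℕ} {x : NChain K G n} :
    x ∈ cycles W n ↔ x ∈ W n ∧ nWordBoundary K G (NChain.toWords n x) = 0 := by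
  cases n with
  | zero => simp [cycles, nWordBoundary_toWords_zero]
  | succ n =>
    rw [← NChain.toWords_d, map_eq_zero_iff _ (NChain.toWords_injective n)]
    rfl

theorem mem_boundaries_iff {W : GradedSub K G} {n : ℕ} {x : NChain K G n} :
    x ∈ boundaries W n
      ↔ ∃ z ∈ wordSub W (n + 1), nWordBoundary K G z = NChain.toWords n x := by
  constructor
  · rintro ⟨y, hy, rfl⟩
    exact ⟨_, toWords_mem_wordSub.2 hy, (NChain.toWords_d n y).symm⟩
  · rintro ⟨_, ⟨y, hy, rfl⟩, h⟩
    exact ⟨y, hy, NChain.toWords_injective n ((NChain.toWords_d n y).trans h)⟩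

theorem homologyClass_surjective {W : GradedSub K G} {n : ℕ} (a : Homology W n) :
    ∃ x, ∃ hx : x ∈ cycles W n, homologyClass W x hx = a := by
  obtain ⟨⟨x, hx⟩, rfl⟩ := Submodule.mkQ_surjective _ a
  exact ⟨x, hx, rfl⟩

/-- Compares classes whose degrees are only propositionally equal, as in associativity and the unit
laws. -/
theorem incl_homologyClass_congr {W : GradedSub K G} {m n : ℕ} (hmn : m = n)
    {x : NChain K G m} {y : NChain K G n} (hx : x ∈ cycles W m) (hy : y ∈ cycles W n)
    (h : NChain.toWords m x = NChain.toWords n y) :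
    incl W m (homologyClass W x hx) = incl W n (homologyClass W y hy) := by
  subst hmn
  obtain rfl := NChain.toWords_injective m h
  rfl

/-- The Eilenberg–Zilber map takes `W ⊗ W'` to `W''`. -/
def EZMapsTo (W : GradedSub K G) (W' : GradedSub K G') (W'' : GradedSub K (G × G')) : Prop :=
  ∀ (p q : ℕ), ∀ x ∈ W p, ∀ y ∈ W' q, ez K p q x y ∈ W'' (p + q)

variable {W : GradedSub K G} {W' : GradedSub K G'} {W'' : GradedSub K (G × G')}

theorem EZMapsTo.ez_mem_cycles (h : EZMapsTo W W' W'') {p q : ℕ} {x : NChain K G p}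
    (hx : x ∈ cycles W p) {y : NChain K G' q} (hy : y ∈ cycles W' q) :
    ez K p q x y ∈ cycles W'' (p + q) := by
  rw [mem_cycles_iff] at hx hy ⊢
  refine ⟨h p q x hx.1 y hy.1, ?_⟩
  simp [nWordBoundary_toWords_ez, hx.2, hy.2]

/-- For a cycle y the Leibniz rule reads ε(∂x ⊗ y) = ∂ε(x ⊗ y). -/
theorem EZMapsTo.ez_mem_boundaries_left (h : EZMapsTo W W' W'') {p q : ℕ} {x : NChain K G p}
    (hx : x ∈ boundaries W p) {y : NChain K G' q} (hy : y ∈ cycles W' q) :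
    ez K p q x y ∈ boundaries W'' (p + q) := by
  obtain ⟨x, hx, rfl⟩ := hx
  rw [mem_cycles_iff] at hy
  rw [mem_boundaries_iff, show p + q + 1 = p + 1 + q by omega]
  refine ⟨_, toWords_mem_wordSub.2 (h _ _ x hx y hy.1), ?_⟩
  rw [nWordBoundary_toWords_ez, hy.2, NChain.toWords_ez, NChain.toWords_d]
  simp

theorem EZMapsTo.ez_mem_boundaries_right (h : EZMapsTo W W' W'') {p q : ℕ} {x : NChain K G p}
    (hx : x ∈ cycles W p) {y : NChain K G' q} (hy : y ∈ boundaries W' q) :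
    ez K p q x y ∈ boundaries W'' (p + q) := by
  obtain ⟨y, hy, rfl⟩ := hy
  rw [mem_cycles_iff] at hx
  -- The factor (-1)ᵖ cancels the sign of the Leibniz rule: for a cycle x, ε(x ⊗ ∂y) = ∂((-1)ᵖ ε(x ⊗
  -- y)).
  refine mem_boundaries_iff.2 ⟨(-1 : K) ^ p • NChain.toWords (p + (q + 1)) (ez K p (q + 1) x y),
    Submodule.smul_mem _ _ (toWords_mem_wordSub.2 (h p (q + 1) x hx.1 y hy)), ?_⟩
  rw [map_smul, nWordBoundary_toWords_ez, hx.2, NChain.toWords_ez, NChain.toWords_d]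
  simp [smul_smul, ← pow_add, Even.neg_one_pow ⟨p, rfl⟩]

theorem homologyClass_eq_zero {n : ℕ} {x : NChain K G n} (hx : x ∈ cycles W n)
    (h : x ∈ boundaries W n) : homologyClass W x hx = 0 :=
  (Submodule.Quotient.mk_eq_zero _).2 h

/-- Cycles times boundaries, in either order, are boundaries, so the bilinear map on cycles descends
in one variable and then, after a flip, in the other. -/
theorem EZMapsTo.exists_inducedByEZ (h : EZMapsTo W W' W'') :
    ∃ c, InducedByEZ W W' W'' c := by
  let B (p q : ℕ) : cycles W p →ₗ[K] cycles W' q →ₗ[K] Homology W'' (p + q) :=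
    LinearMap.mk₂ K (fun x y => homologyClass W'' (ez K p q x y) (h.ez_mem_cycles x.2 y.2))
      (fun x x' y => by
        simp only [Submodule.coe_add, map_add, LinearMap.add_apply]
        rfl)
      (fun r x y => by
        simp only [Submodule.coe_smul, map_smul, LinearMap.smul_apply]
        rfl)
      (fun x y y' => by
        simp only [Submodule.coe_add, map_add]
        rfl)
      (fun r x y => by
        simp only [Submodule.coe_smul, map_smul]
        rfl)
  let c (p q : ℕ) : Homology W p →ₗ[K] Homology W' q →ₗ[K] Homology W'' (p + q) :=
    (((boundaries W' q).submoduleOf (cycles W' q)).liftQ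
      (((boundaries W p).submoduleOf (cycles W p)).liftQ (B p q) (fun x hx =>
        LinearMap.ext fun y =>
          homologyClass_eq_zero _ (h.ez_mem_boundaries_left hx y.2))).flip
      (fun y hy => LinearMap.ext fun x => by
        obtain ⟨x, rfl⟩ := Submodule.mkQ_surjective _ x
        exact homologyClass_eq_zero _ (h.ez_mem_boundaries_right x.2 hy))).flip
  exact ⟨c, fun p q x hx y hy => ⟨h.ez_mem_cycles hx hy, rfl⟩⟩

theorem ezMapsTo_full : EZMapsTo (full K G) (full K G') (full K (G × G')) :=
  fun _ _ _ _ _ _ => Submodule.mem_top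

theorem ezMapsTo_pathSub (X : Set G) (X' : Set G') :
    EZMapsTo (pathSub K X) (pathSub K X') (pathSub K (wedge X X')) := by
  intro p q x hx y hy
  suffices h : pathSub K X p ≤ (pathSub K (wedge X X') (p + q)).comap ((ez K p q).flip y) from h hx
  refine Submodule.span_le.2 ?_
  rintro _ ⟨g, hg, rfl⟩
  simp only [Submodule.comap_coe, Set.mem_preimage, SetLike.mem_coe, LinearMap.flip_apply]
  suffices h : pathSub K X' q ≤ (pathSub K (wedge X X') (p + q)).comap
    (ez K p q (simplex K g)) from h hy
  refine Submodule.span_le.2 ?_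
  rintro _ ⟨g', hg', rfl⟩
  simp only [Submodule.comap_coe, Set.mem_preimage, SetLike.mem_coe]
  rw [simplex, simplex, ez_proj_proj]
  simp only [ezChain, Finsupp.linearCombination_single, one_smul, map_sum]
  refine Submodule.sum_mem _ fun e _ => ?_
  rw [← mul_one (((e.sgn : ℤˣ) : ℤ) : K), ← smul_eq_mul, ← Finsupp.smul_single, map_smul]
  refine Submodule.smul_mem _ _ (Submodule.subset_span ⟨_, fun k => ?_, rfl⟩)
  obtain ⟨s, rfl⟩ := e.1.surjective k
  simp only [Shuffle.degenLeft, Shuffle.degenRight, Equiv.symm_apply_apply]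
  rcases s with i | j
  · exact Or.inl ⟨hg i, rfl⟩
  · exact Or.inr ⟨rfl, hg' j⟩

/-! ### Passage to the largest subcomplex -/

/-- The condition indexed by `m` is vacuous in degree 0, which allows both cases of `omega` to be
treated together. -/
theorem mem_omega_iff {D : GradedSub K G} {n : ℕ} {x : NChain K G n} :
    x ∈ omega D n ↔ x ∈ D n ∧
      ∀ m, n = m + 1 → nWordBoundary K G (NChain.toWords n x) ∈ wordSub D m := by
  cases n with
  | zero => simp [omega]
  | succ n =>
    simp only [Nat.add_right_cancel_iff, forall_eq', ← NChain.toWords_d, toWords_mem_wordSub]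
    rfl

/-- If `ε` maps `D ⊗ D'` to `D''`, it maps `ω(N G, D) ⊗ ω(N G', D')` to `ω(N (G × G'), D'')`. -/
theorem EZMapsTo.omega {D : GradedSub K G} {D' : GradedSub K G'} {D'' : GradedSub K (G × G')}
    (h : EZMapsTo D D' D'') :
    EZMapsTo (SubsetHomology.omega D) (SubsetHomology.omega D') (SubsetHomology.omega D'') := by
  intro p q x hx y hy
  rw [mem_omega_iff] at hx hy ⊢
  refine ⟨h p q x hx.1 y hy.1, fun m hm => ?_⟩
  rw [nWordBoundary_toWords_ez]
  refine add_mem ?_ (Submodule.smul_mem _ _ ?_)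
  · cases p with
    | zero => simp [nWordBoundary_toWords_zero]
    | succ p =>
      obtain ⟨z, hz, hzx⟩ := hx.2 p rfl
      obtain rfl : m = p + q := by omega
      rw [← hzx, ← NChain.toWords_ez]
      exact toWords_mem_wordSub.2 (h p q z hz y hy.1)
  · cases q with
    | zero => simp [nWordBoundary_toWords_zero]
    | succ q =>
      obtain ⟨z, hz, hzy⟩ := hy.2 q rfl
      obtain rfl : m = p + q := by omega
      rw [← hzy, ← NChain.toWords_ez]
      exact toWords_mem_wordSub.2 (h p q x hx.1 z hz)

end EZProducts

/-! ### Pontryagin products -/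

section Pontryagin

variable {K : Type w} [CommRing K] {G : Type u} [CommGroup G] {G' : Type v} [CommGroup G']

/-- The Pontryagin product of normalized chains. -/
def chainProduct (p q : ℕ) (x : NChain K G p) (y : NChain K G q) : NChain K G (p + q) :=
  nMap K mulMonoidHom (p + q) (ez K p q x y)

/-- Multiplication composed with either inclusion of `G` in `G × G` is the identity, and
homomorphisms respect shuffles, so the product becomes the shuffle product of words in `G` itself.
-/
theorem toWords_chainProduct (p q : ℕ) (x : NChain K G p) (y : NChain K G q) :
    NChain.toWords (p + q) (chainProduct p q x y)
      = nShuffle K (NChain.toWords p x) (NChain.toWords q y) := by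
  have hl (a : NWordChain K G) : nWordMap K mulMonoidHom (nWordMap K (MonoidHom.inl G G) a) = a := by
    obtain ⟨a, rfl⟩ := Submodule.mkQ_surjective _ a
    rw [nWordMap_mk, nWordMap_mk]
    congr 1
    suffices h : wordMap K (mulMonoidHom : G × G →* G) ∘ₗ wordMap K (MonoidHom.inl G G)
      = LinearMap.id from LinearMap.congr_fun h a
    exact linearMap_ext_word fun l => by simp [Function.comp_def]
  have hr (a : NWordChain K G) : nWordMap K mulMonoidHom (nWordMap K (MonoidHom.inr G G) a) = a := by
    obtain ⟨a, rfl⟩ := Submodule.mkQ_surjective _ a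
    rw [nWordMap_mk, nWordMap_mk]
    congr 1
    suffices h : wordMap K (mulMonoidHom : G × G →* G) ∘ₗ wordMap K (MonoidHom.inr G G)
      = LinearMap.id from LinearMap.congr_fun h a
    exact linearMap_ext_word fun l => by simp [Function.comp_def]
  rw [chainProduct, NChain.toWords_nMap, NChain.toWords_ez, ← nShuffle_nWordMap, hl, hr]

/-- The bilinear map `m` on `H_*(W)` is induced by the Pontryagin product of chains. -/
def InducedByChainProduct {W : GradedSub K G}
    (m : TotalHomology W →ₗ[K] TotalHomology W →ₗ[K] TotalHomology W) : Prop :=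
  ∀ (p q : ℕ) (x : NChain K G p) (hx : x ∈ cycles W p) (y : NChain K G q) (hy : y ∈ cycles W q),
    ∃ h : chainProduct p q x y ∈ cycles W (p + q),
      m (incl W p (homologyClass W x hx)) (incl W q (homologyClass W y hy))
        = incl W (p + q) (homologyClass W (chainProduct p q x y) h)

theorem TotalHomology.induction {W : GradedSub K G} {P : TotalHomology W → Prop}
    (zero : P 0) (add : ∀ a b, P a → P b → P (a + b))
    (class_mem : ∀ (n : ℕ) (x : NChain K G n) (hx : x ∈ cycles W n),
      P (incl W n (homologyClass W x hx))) (a : TotalHomology W) : P a := by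
  induction a using DirectSum.induction_on with
  | zero => exact zero
  | of n a =>
    obtain ⟨x, hx, rfl⟩ := homologyClass_surjective a
    exact class_mem n x hx
  | add a b ha hb => exact add a b ha hb

theorem exists_bilinear_incl {W : GradedSub K G}
    (t : ∀ p q : ℕ, Homology W p →ₗ[K] Homology W q →ₗ[K] Homology W (p + q)) :
    ∃ m : TotalHomology W →ₗ[K] TotalHomology W →ₗ[K] TotalHomology W,
      ∀ p q a b, m (incl W p a) (incl W q b) = incl W (p + q) (t p q a b) := by
  refine ⟨DirectSum.toModule K ℕ _ fun p => (DirectSum.toModule K ℕ _ fun q =>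
    ((t p q).compr₂ (incl W (p + q))).flip).flip, fun p q a b => ?_⟩
  rw [incl, incl, DirectSum.toModule_lof, LinearMap.flip_apply, DirectSum.toModule_lof,
    LinearMap.flip_apply, LinearMap.compr₂_apply]

theorem InducedByChainProduct.ext {W : GradedSub K G}
    {m m' : TotalHomology W →ₗ[K] TotalHomology W →ₗ[K] TotalHomology W}
    (h : InducedByChainProduct m) (h' : InducedByChainProduct m') : m = m' := by
  refine LinearMap.ext fun a => LinearMap.ext fun b => ?_
  induction a using TotalHomology.induction with
  | zero => simp
  | add a a' ha ha' => simp only [map_add, LinearMap.add_apply, ha, ha']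
  | class_mem p x hx =>
    induction b using TotalHomology.induction with
    | zero => simp
    | add b b' hb hb' => simp only [map_add, hb, hb']
    | class_mem q y hy =>
      obtain ⟨_, e⟩ := h p q x hx y hy
      obtain ⟨_, e'⟩ := h' p q x hx y hy
      rw [e, e']

/-- Each law already holds for chains; by linearity it suffices to test it on classes of cycles. -/
theorem InducedByChainProduct.isGradedCommAlgebra {W : GradedSub K G}
    {m : TotalHomology W →ₗ[K] TotalHomology W →ₗ[K] TotalHomology W}
    (h : InducedByChainProduct m)
    (hv : (simplex K (fun i : Fin 0 => i.elim0) : NChain K G 0) ∈ cycles W 0) :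
    IsGradedCommAlgebra m (incl W 0 (homologyClass W _ hv)) where
  one_mem := ⟨_, rfl⟩
  mul_mem p q a b := by
    obtain ⟨x, hx, rfl⟩ := homologyClass_surjective a
    obtain ⟨y, hy, rfl⟩ := homologyClass_surjective b
    obtain ⟨_, e⟩ := h p q x hx y hy
    exact ⟨_, e.symm⟩
  one_mul a := by
    induction a using TotalHomology.induction with
    | zero => simp
    | add a a' ha ha' => simp only [map_add, ha, ha']
    | class_mem p x hx =>
      obtain ⟨_, e⟩ := h 0 p _ hv x hx
      rw [e]
      refine incl_homologyClass_congr (zero_add p) _ _ ?_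
      rw [toWords_chainProduct, NChain.toWords_vertex, nShuffle_nil_left]
  mul_one a := by
    induction a using TotalHomology.induction with
    | zero => simp
    | add a a' ha ha' => simp only [map_add, LinearMap.add_apply, ha, ha']
    | class_mem p x hx =>
      obtain ⟨_, e⟩ := h p 0 x hx _ hv
      rw [e]
      refine incl_homologyClass_congr (add_zero p) _ _ ?_
      rw [toWords_chainProduct, NChain.toWords_vertex, nShuffle_nil_right]
  mul_assoc a b c := by
    induction a using TotalHomology.induction with
    | zero => simp
    | add a a' ha ha' => simp only [map_add, LinearMap.add_apply, ha, ha']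
    | class_mem p x hx =>
      induction b using TotalHomology.induction with
      | zero => simp
      | add b b' hb hb' => simp only [map_add, LinearMap.add_apply, hb, hb']
      | class_mem q y hy =>
        induction c using TotalHomology.induction with
        | zero => simp
        | add c c' hc hc' => simp only [map_add, hc, hc']
        | class_mem r z hz =>
          obtain ⟨hxy, e₁⟩ := h p q x hx y hy
          obtain ⟨hyz, e₂⟩ := h q r y hy z hz
          obtain ⟨_, e₃⟩ := h _ r _ hxy z hz
          obtain ⟨_, e₄⟩ := h p _ x hx _ hyz
          rw [e₁, e₂, e₃, e₄]
          refine incl_homologyClass_congr (add_assoc p q r) _ _ ?_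
          simp only [toWords_chainProduct, nShuffle_assoc]
  graded_comm p q a b := by
    obtain ⟨x, hx, rfl⟩ := homologyClass_surjective a
    obtain ⟨y, hy, rfl⟩ := homologyClass_surjective b
    obtain ⟨hxy, e₁⟩ := h p q x hx y hy
    obtain ⟨hyx, e₂⟩ := h q p y hy x hx
    -- The sign is moved inside, so that each side is the class of a single cycle, in degree `p + q`
    -- and `q + p` respectively.
    rw [e₁, e₂, ← map_smul]
    refine incl_homologyClass_congr (add_comm p q) (y := (-1 : K) ^ (p * q) • chainProduct q p y x)
      hxy (Submodule.smul_mem _ _ hyx) ?_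
    rw [map_smul, toWords_chainProduct, toWords_chainProduct, nShuffle_toWords_comm]

/-! ### Naturality and the case of the whole group -/

theorem totalHomologyMap_incl {W : GradedSub K G} {W' : GradedSub K G'} (f : G →* G')
    (hf : ∀ n, W n ≤ (W' n).comap (nMap K f n)) (n : ℕ) (x : NChain K G n)
    (hx : x ∈ cycles W n) :
    totalHomologyMap f hf (incl W n (homologyClass W x hx))
      = incl W' n (homologyClass W' (nMap K f n x) (nMap_mem_cycles f hf n x hx)) := by
  rw [totalHomologyMap, incl, DirectSum.lmap_lof]
  rfl

theorem totalHomologyMap_vertex {W : GradedSub K G} {W' : GradedSub K G'} (f : G →* G')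
    (hf : ∀ n, W n ≤ (W' n).comap (nMap K f n))
    (hv : (simplex K (fun i : Fin 0 => i.elim0) : NChain K G 0) ∈ cycles W 0)
    (hv' : (simplex K (fun i : Fin 0 => i.elim0) : NChain K G' 0) ∈ cycles W' 0) :
    totalHomologyMap f hf (incl W 0 (homologyClass W _ hv))
      = incl W' 0 (homologyClass W' _ hv') := by
  rw [totalHomologyMap_incl]
  refine incl_homologyClass_congr rfl _ _ ?_
  rw [nMap_simplex]
  congr 2
  exact Subsingleton.elim _ _

/-- A homomorphism acts letter by letter and so commutes with shuffling. Stated for arbitrary `W`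
and `W'`, it serves both naturality in (G, X) and the comparison with group homology. -/
theorem InducedByChainProduct.totalHomologyMap_mul {W : GradedSub K G} {W' : GradedSub K G'}
    {m : TotalHomology W →ₗ[K] TotalHomology W →ₗ[K] TotalHomology W}
    {m' : TotalHomology W' →ₗ[K] TotalHomology W' →ₗ[K] TotalHomology W'}
    (h : InducedByChainProduct m) (h' : InducedByChainProduct m') (f : G →* G')
    (hf : ∀ n, W n ≤ (W' n).comap (nMap K f n)) (a b : TotalHomology W) :
    totalHomologyMap f hf (m a b) = m' (totalHomologyMap f hf a) (totalHomologyMap f hf b) := by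
  induction a using TotalHomology.induction with
  | zero => simp
  | add a a' ha ha' => simp only [map_add, LinearMap.add_apply, ha, ha']
  | class_mem p x hx =>
    induction b using TotalHomology.induction with
    | zero => simp
    | add b b' hb hb' => simp only [map_add, hb, hb']
    | class_mem q y hy =>
      obtain ⟨_, e⟩ := h p q x hx y hy
      obtain ⟨_, e'⟩ := h' p q _ (nMap_mem_cycles f hf p x hx) _ (nMap_mem_cycles f hf q y hy)
      rw [e]
      simp only [totalHomologyMap_incl]
      rw [e']
      refine incl_homologyClass_congr rfl _ _ ?_
      simp only [NChain.toWords_nMap, toWords_chainProduct, nShuffle_nWordMap]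

theorem totalHomologyMap_id_bijective {W W' : GradedSub K G} (hW : W = W')
    (hf : ∀ n, W n ≤ (W' n).comap (nMap K (MonoidHom.id G) n)) :
    Function.Bijective (totalHomologyMap (MonoidHom.id G) hf) := by
  -- Once the two subcomplexes are identified, the map induced by the identity homomorphism is the
  -- identity.
  subst hW
  suffices h : totalHomologyMap (MonoidHom.id G) hf = LinearMap.id by
    rw [h]
    exact Function.bijective_id
  refine LinearMap.ext fun a => ?_
  induction a using TotalHomology.induction with
  | zero => simp
  | add a b ha hb => rw [map_add, map_add, ha, hb]
  | class_mem n x hx =>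
    rw [totalHomologyMap_incl]
    refine incl_homologyClass_congr rfl _ _ ?_
    congr 1
    obtain ⟨x, rfl⟩ := proj_surjective K G _ x
    rw [nMap, NChain.lift_proj, LinearMap.comp_apply]
    congr 1
    exact Finsupp.mapDomain_id

/-- All simplices are admissible, so `pathSub` is everything and the condition on the boundary is
vacuous. -/
theorem Omega_univ : Omega K (Set.univ : Set G) = full K G := by
  have h (n : ℕ) : pathSub K (Set.univ : Set G) n = ⊤ := by
    rw [eq_top_iff]
    rintro x -
    obtain ⟨x, rfl⟩ := proj_surjective K G _ x
    induction x using Finsupp.induction_linear with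
    | zero => simp
    | add x y hx hy => rw [map_add]; exact add_mem hx hy
    | single g c =>
      rw [← mul_one c, ← smul_eq_mul, ← Finsupp.smul_single, map_smul]
      exact Submodule.smul_mem _ _ (Submodule.subset_span ⟨g, fun _ => trivial, rfl⟩)
  funext n
  cases n with
  | zero => exact h 0
  | succ n => simp [Omega, omega, full, h]

/-! ### Existence and uniqueness of the Pontryagin products -/

theorem IsPontryaginProduct.inducedByChainProduct {X : Set G}
    {m : TotalHomology (Omega K X) →ₗ[K] TotalHomology (Omega K X) →ₗ[K]
      TotalHomology (Omega K X)} (h : IsPontryaginProduct X m) : InducedByChainProduct m := by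
  obtain ⟨c, hc, hm⟩ := h
  intro p q x hx y hy
  obtain ⟨hxy, e⟩ := hc p q x hx y hy
  refine ⟨nMap_mem_cycles _ (Omega_le_comap K _ (mapsTo_mul_wedge X)) _ _ hxy, ?_⟩
  rw [hm, e]
  rfl

theorem IsClassicalPontryaginProduct.inducedByChainProduct
    {m : TotalHomology (full K G) →ₗ[K] TotalHomology (full K G) →ₗ[K]
      TotalHomology (full K G)} (h : IsClassicalPontryaginProduct m) :
    InducedByChainProduct m := by
  obtain ⟨c, hc, hm⟩ := h
  intro p q x hx y hy
  obtain ⟨hxy, e⟩ := hc p q x hx y hy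
  refine ⟨nMap_mem_cycles (W' := full K G) _ (fun _ _ _ => Submodule.mem_top) _ _ hxy, ?_⟩
  rw [hm, e]
  rfl

/-- Existence rests on ε preserving Ω. For uniqueness, any such product is prescribed by
`chainProduct` on classes of cycles, and these span. -/
theorem existsUnique_isPontryaginProduct (X : Set G) :
    ∃! m : TotalHomology (Omega K X) →ₗ[K] TotalHomology (Omega K X) →ₗ[K]
      TotalHomology (Omega K X), IsPontryaginProduct X m := by
  have hX : EZMapsTo (Omega K X) (Omega K X) (Omega K (wedge X X)) :=
    (ezMapsTo_pathSub X X).omega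
  obtain ⟨c, hc⟩ := hX.exists_inducedByEZ
  obtain ⟨m, hm⟩ := exists_bilinear_incl fun p q => (c p q).compr₂
    (homologyMap (mulMonoidHom : G × G →* G) (Omega_le_comap K _ (mapsTo_mul_wedge X)) (p + q))
  have h : IsPontryaginProduct X m := ⟨c, hc, hm⟩
  exact ⟨m, h, fun m' h' => h'.inducedByChainProduct.ext h.inducedByChainProduct⟩

theorem existsUnique_isClassicalPontryaginProduct :
    ∃! m : TotalHomology (full K G) →ₗ[K] TotalHomology (full K G) →ₗ[K]
      TotalHomology (full K G), IsClassicalPontryaginProduct m := by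
  obtain ⟨c, hc⟩ := (ezMapsTo_full (K := K) (G := G) (G' := G)).exists_inducedByEZ
  obtain ⟨m, hm⟩ := exists_bilinear_incl fun p q => (c p q).compr₂
    (homologyMap (W' := full K G) mulMonoidHom (fun _ _ _ => Submodule.mem_top) (p + q))
  have h : IsClassicalPontryaginProduct m := ⟨c, hc, hm⟩
  exact ⟨m, h, fun m' h' => h'.inducedByChainProduct.ext h.inducedByChainProduct⟩

end Pontryagin

end SubsetHomology

end

theorem mainTheorem12 (K : Type w) [CommRing K] (G : Type u) [CommGroup G] (X : Set G)
    (hX : (1 : G) ∈ X) :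
    -- the Pontryagin product on `H_*(G, X)` is well defined
    (∃! m : TotalHomology (Omega K X) →ₗ[K] TotalHomology (Omega K X) →ₗ[K]
      TotalHomology (Omega K X), IsPontryaginProduct X m) ∧
    -- it makes `H_*(G, X)` a graded-commutative, associative, unital algebra
    (∀ m : TotalHomology (Omega K X) →ₗ[K] TotalHomology (Omega K X) →ₗ[K]
      TotalHomology (Omega K X), IsPontryaginProduct X m →
        IsGradedCommAlgebra m (subsetOne K X)) ∧
    -- this structure is natural in `(G, X)`
    (∀ (G' : Type v) [CommGroup G'] (X' : Set G'), (1 : G') ∈ X' →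
      ∀ (f : G →* G') (hf : Set.MapsTo f X X')
        (m : TotalHomology (Omega K X) →ₗ[K] TotalHomology (Omega K X) →ₗ[K]
          TotalHomology (Omega K X))
        (m' : TotalHomology (Omega K X') →ₗ[K] TotalHomology (Omega K X') →ₗ[K]
          TotalHomology (Omega K X')),
        IsPontryaginProduct X m → IsPontryaginProduct X' m' →
          subsetMap K f hf (subsetOne K X) = subsetOne K X' ∧
          ∀ a b, subsetMap K f hf (m a b) = m' (subsetMap K f hf a) (subsetMap K f hf b)) ∧
    -- for `X = G` it is the classical Pontryagin product on `H_*(G)`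
    (X = Set.univ →
      (∃! m₀ : TotalHomology (full K G) →ₗ[K] TotalHomology (full K G) →ₗ[K]
        TotalHomology (full K G), IsClassicalPontryaginProduct m₀) ∧
      Function.Bijective (toGroupHomology K X) ∧
      toGroupHomology K X (subsetOne K X) = groupOne K G ∧
      ∀ (m : TotalHomology (Omega K X) →ₗ[K] TotalHomology (Omega K X) →ₗ[K]
          TotalHomology (Omega K X))
        (m₀ : TotalHomology (full K G) →ₗ[K] TotalHomology (full K G) →ₗ[K]
          TotalHomology (full K G)),
        IsPontryaginProduct X m → IsClassicalPontryaginProduct m₀ →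
          ∀ a b, toGroupHomology K X (m a b)
            = m₀ (toGroupHomology K X a) (toGroupHomology K X b)) := by
  refine ⟨existsUnique_isPontryaginProduct X,
    fun m hm => hm.inducedByChainProduct.isGradedCommAlgebra _,
    fun G' _ X' _ f hf m m' hm hm' => ⟨totalHomologyMap_vertex f _ _ _, fun a b =>
      hm.inducedByChainProduct.totalHomologyMap_mul hm'.inducedByChainProduct f _ a b⟩, ?_⟩
  -- `toGroupHomology` is the map induced by the identity homomorphism, so the naturality lemmas
  -- also compare the subset product with the classical one.
  rintro rfl
  exact ⟨existsUnique_isClassicalPontryaginProduct, totalHomologyMap_id_bijective Omega_univ _,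
    totalHomologyMap_vertex _ _ _ _, fun m m₀ hm hm₀ a b =>
      hm.inducedByChainProduct.totalHomologyMap_mul hm₀.inducedByChainProduct _ _ a b⟩
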